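/- Let $T>0$ and $d,n\in\mathbb N$. Let $b:[0,T]\times\mathbb R^d\to\mathbb R^d$ be measurable with $b(t,\cdot)$ linear for every $t$, let $\sigma_0:[0,T]\to\mathbb R^{d\times d}$ and $\sigma_1:[0,T]\to\mathbb R^{d\times n}$ be square integrable, and let $h:\mathbb R^d\to\mathbb R^n$ be measurable. Suppose that $\sigma_1$ is not zero almost everywhere on $[0,T]$ (correlated noise). On some probability space let $B$ and $W$ be independent standard Brownian motions of dimensions $d$ and $n$, and let $X$ and $Y$ be random continuous paths, with values in $C([0,T],\mathbb R^d)$ and $C([0,T],\mathbb R^n)$ and with $\int_0^T|b(s,X_s)|\,ds<\infty$ and $\int_0^T|h(X_s)|\,ds<\infty$ almost surely, such that almost surely, for all $t\in[0,T]$, $$X_t=X_0+\int_0^t b(s,X_s)\,ds+\int_0^t\sigma_0(s)\,dB_s+\int_0^t\sigma_1(s)\,dW_s,\qquad Y_t=\int_0^t h(X_s)\,ds+W_t .$$ Let $P_X$, $P_Y$ and $P_{XY}$ be the laws of $X$, $Y$ and $(X,Y)$ on the path spaces with their Borel $\sigma$-algebras (of the uniform norm). Then $P_{XY}$ and $P_X\otimes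 P_Y$ are mutually singular, and there is no $\sigma$-finite measure $\lambda_Y$ on $C([0,T],\mathbb R^n)$ such that $P_{XY}\ll P_X\otimes\lambda_Y$. -/

import Mathlib

open MeasureTheory ProbabilityTheory Filter Topology
open scoped NNReal ENNReal

namespace Filtering

/-- The path space `C([0,T], ℝᵐ)`; its topology is that of uniform convergence. -/
abbrev PathSpace (T : ℝ) (m : ℕ) : Type :=
  C(Set.Icc (0 : ℝ) T, EuclideanSpace ℝ (Fin m))

/-- The path space carries its Borel `σ`-algebra. -/
instance PathSpace.instMeasurableSpace (T : ℝ) (m : ℕ) : MeasurableSpace (PathSpace T m) :=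
  borel _

instance PathSpace.instBorelSpace (T : ℝ) (m : ℕ) : BorelSpace (PathSpace T m) :=
  ⟨rfl⟩

/-- The value of the path `x` at the real time `s`. Only times `s ∈ [0,T]` matter below; outside
that interval the path is continued by its end values. -/
noncomputable def PathSpace.at {T : ℝ} {m : ℕ} (hT : 0 ≤ T) (x : PathSpace T m) (s : ℝ) :
    EuclideanSpace ℝ (Fin m) :=
  x (Set.projIcc 0 T hT s)

/-- `β` is a standard Brownian motion with values in `ℝ^ι`: its coordinates are real Brownian
motions started at `0` and, as processes, mutually independent. -/
structure IsStdBrownian {Ω : Type*} [MeasurableSpace Ω] {ι : Type*}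
    (β : ι → ℝ≥0 → Ω → ℝ) (P : Measure Ω) : Prop where
  isBrownian : ∀ i, IsBrownianReal (β i) P
  indep : iIndepFun (fun i ω (t : ℝ≥0) ↦ β i t ω) P

/-- A deterministic step function on `[0,∞)`, equal to `val k` on `(time k, time (k+1)]` for
`k < num`, and to `0` elsewhere. -/
structure StepFunction where
  num : ℕ
  time : ℕ → ℝ≥0
  monotone_time : Monotone time
  val : ℕ → ℝ

/-- The function described by a `StepFunction`. -/
noncomputable def StepFunction.toFun (φ : StepFunction) (s : ℝ) : ℝ :=
  ∑ k ∈ Finset.range φ.num,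
    (Set.Ioc (φ.time k : ℝ) (φ.time (k + 1) : ℝ)).indicator (fun _ ↦ φ.val k) s

/-- The elementary stochastic integral `∫₀ᵗ φ dβ` of a step function. -/
noncomputable def StepFunction.integral {Ω : Type*} (φ : StepFunction) (β : ℝ≥0 → Ω → ℝ)
    (t : ℝ≥0) (ω : Ω) : ℝ :=
  ∑ k ∈ Finset.range φ.num,
    φ.val k * (β (min (φ.time (k + 1)) t) ω - β (min (φ.time k) t) ω)

/-- `I` is (a version of) the stochastic integral `∫₀ᵗ f dβ` of the deterministic function
`f ∈ L²(0,t)` against `β`: it is the limit in `L²(P)` of the elementary integrals of step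
functions that converge to `f` in `L²(0,t)`. If `β` is a Brownian motion, then by the Itô isometry
such an `I` exists for every `f ∈ L²(0,t)`, it is unique up to almost sure equality, and it does not
depend on the approximating sequence. -/
def HasItoIntegral {Ω : Type*} [MeasurableSpace Ω] (P : Measure Ω) (β : ℝ≥0 → Ω → ℝ)
    (f : ℝ → ℝ) (t : ℝ≥0) (I : Ω → ℝ) : Prop :=
  MemLp f 2 (volume.restrict (Set.Ioc 0 (t : ℝ))) ∧
  MemLp I 2 P ∧
  ∃ φ : ℕ → StepFunction,
    Tendsto (fun k ↦ eLpNorm (fun s ↦ (φ k).toFun s - f s) 2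
      (volume.restrict (Set.Ioc 0 (t : ℝ)))) atTop (𝓝 0) ∧
    Tendsto (fun k ↦ eLpNorm (fun ω ↦ (φ k).integral β t ω - I ω) 2 P) atTop (𝓝 0)

/-- `(X, Y)`, a pair of random continuous paths on `[0,T]` driven by `(B, W)`, solves
`X_t = X_0 + ∫₀ᵗ b(s, X_s) ds + ∫₀ᵗ σ₀(s) dB_s + ∫₀ᵗ σ₁(s) dW_s`,
`Y_t = ∫₀ᵗ h(X_s) ds + W_t`, for `t ∈ [0,T]`,
where `(B, W)` is a `(d+n)`-dimensional standard Brownian motion.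

The diffusion coefficients are deterministic, so the stochastic integrals need no filtration, and
neither adaptedness of `(X, Y)` nor anything about `X_0` is required: all weak and strong solutions
on filtered probability spaces, with any initial law, are covered. -/
structure IsSignalObservation {Ω : Type*} [MeasurableSpace Ω] (P : Measure Ω)
    {T : ℝ} (hT : 0 ≤ T) {d n : ℕ}
    (b : ℝ → EuclideanSpace ℝ (Fin d) → EuclideanSpace ℝ (Fin d))
    (σ₀ : ℝ → Matrix (Fin d) (Fin d) ℝ) (σ₁ : ℝ → Matrix (Fin d) (Fin n) ℝ)
    (h : EuclideanSpace ℝ (Fin d) → EuclideanSpace ℝ (Fin n))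
    (B : Fin d → ℝ≥0 → Ω → ℝ) (W : Fin n → ℝ≥0 → Ω → ℝ)
    (X : Ω → PathSpace T d) (Y : Ω → PathSpace T n) : Prop where
  brownian : IsStdBrownian (Sum.elim B W) P
  measurable_signal : Measurable X
  measurable_observation : Measurable Y
  drift_integrable :
    ∀ᵐ ω ∂P, IntervalIntegrable (fun s ↦ b s ((X ω).at hT s)) volume 0 T
  observation_integrable :
    ∀ᵐ ω ∂P, IntervalIntegrable (fun s ↦ h ((X ω).at hT s)) volume 0 T
  signal_eq : ∀ t ∈ Set.Icc (0 : ℝ) T,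
    ∃ (I₀ : Fin d → Fin d → Ω → ℝ) (I₁ : Fin d → Fin n → Ω → ℝ),
      (∀ i j, HasItoIntegral P (B j) (fun s ↦ σ₀ s i j) t.toNNReal (I₀ i j)) ∧
      (∀ i j, HasItoIntegral P (W j) (fun s ↦ σ₁ s i j) t.toNNReal (I₁ i j)) ∧
      ∀ᵐ ω ∂P, ∀ i,
        (X ω).at hT t i = (X ω).at hT 0 i + (∫ s in (0 : ℝ)..t, b s ((X ω).at hT s)) i
          + ∑ j, I₀ i j ω + ∑ j, I₁ i j ω
  observation_eq : ∀ t ∈ Set.Icc (0 : ℝ) T, ∀ᵐ ω ∂P, ∀ j,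
    (Y ω).at hT t j = (∫ s in (0 : ℝ)..t, h ((X ω).at hT s)) j + W j t.toNNReal ω

end Filtering

/-! ### Wiener integrals and their isometry. -/

namespace Filtering

variable {Ω : Type*} [MeasurableSpace Ω] {P : Measure Ω} {β : ℝ≥0 → Ω → ℝ}

/-! Quadratic covariation can be read off the paths, and it tells the two laws apart. For a
coordinate `i` of the signal and `l` of the observation, the covariation sums over the grid of
`[0,t]` with `m` equal intervals are measurable functions of the pair of paths. Under the joint law
they converge in probability to `∫₀ᵗ σ₁ s i l ds`: the drifts have finite variation and contribute
nothing, and among the components of `(B, W)` only `W l` covaries with itself. The product law is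
the law of `(X ω, Y ω')` on `Ω × Ω`; there the noises of signal and observation are independent and
the same sums tend to `0`. Since `σ₁` is not a.e. zero, some `i`, `l`, `t` make the first limit
nonzero. Along a common subsequence both convergences are almost sure, so the set where the sums
tend to the first limit has full measure for one law and measure zero for the other.

The core is `integral_abs_sum_increments_sub_le`, whose inputs are the isometry for deterministic
integrands and the orthogonality of compensated products of increments (`HasCrossVariation`).
`exists_subseq_tendsto_gridCovariation` adds the drifts and is applied twice, on `Ω` and on `Ω × Ω`.
The claim about an arbitrary reference measure follows from singularity by Lebesgue decomposition
with respect to the law of `Y`. -/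

lemma memLp_two_brownian (hβ : IsPreBrownianReal β P) (t : ℝ≥0) : MemLp (β t) 2 P :=
  (hβ.isGaussianProcess.hasGaussianLaw_eval t).memLp_two

lemma integral_brownian_mul (hβ : IsPreBrownianReal β P) (s t : ℝ≥0) :
    ∫ ω, β s ω * β t ω ∂P = min (s : ℝ) t := by
  have : IsProbabilityMeasure P := hβ.isGaussianProcess.isProbabilityMeasure
  have h := hβ.covariance_eval s t
  rw [covariance_eq_sub (memLp_two_brownian hβ s) (memLp_two_brownian hβ t),
    hβ.integral_eval, zero_mul, sub_zero] at h
  simpa using h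

/-- The closed graph of the Wiener integral with respect to `β`, as a subspace of
`L²(ℝ) × L²(P)`. -/
noncomputable def itoGraph (P : Measure Ω) (β : ℝ≥0 → Ω → ℝ) :
    Submodule ℝ (Lp ℝ 2 (volume : Measure ℝ) × Lp ℝ 2 P) :=
  (Submodule.span ℝ {p | ∃ u : ℝ≥0,
    p.1 =ᵐ[volume] (Set.Ioc 0 (u : ℝ)).indicator (fun _ ↦ (1 : ℝ)) ∧
    p.2 =ᵐ[P] β u}).topologicalClosure

/-- The generators satisfy the isometry because `⟨1_(0,u], 1_(0,v]⟩ = min u v = E[β u β v]`.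
Bilinearity carries equality of inner products to the span, and continuity of the norms to its
closure. -/
lemma norm_eq_of_mem_itoGraph (hβ : IsPreBrownianReal β P)
    {p : Lp ℝ 2 (volume : Measure ℝ) × Lp ℝ 2 P} (hp : p ∈ itoGraph P β) : ‖p.1‖ = ‖p.2‖ := by
  have hclosed : IsClosed {p : Lp ℝ 2 (volume : Measure ℝ) × Lp ℝ 2 P | ‖p.1‖ = ‖p.2‖} :=
    isClosed_eq (by fun_prop) (by fun_prop)
  refine closure_minimal ?_ hclosed hp
  intro p hp
  have key : inner ℝ p.1 p.1 = inner ℝ p.2 p.2 := by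
    refine Submodule.span_induction₂ (p := fun x y _ _ ↦ inner ℝ x.1 y.1 = inner ℝ x.2 y.2)
      ?_ ?_ ?_ ?_ ?_ ?_ ?_ hp hp
    · rintro x y ⟨u, hu, hu'⟩ ⟨v, hv, hv'⟩
      rw [L2.inner_def, L2.inner_def]
      have h1 : ∫ a, inner ℝ (x.1 a) (y.1 a) = ∫ a, (Set.Ioc (0 : ℝ) (min u v : ℝ)).indicator
          (fun _ ↦ (1 : ℝ)) a := by
        refine integral_congr_ae ?_
        filter_upwards [hu, hv] with a ha hb
        rw [ha, hb]
        simp only [Set.indicator, Set.mem_Ioc, le_min_iff, RCLike.inner_apply, conj_trivial]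
        split_ifs <;> simp_all
      have h2 : ∫ a, inner ℝ (x.2 a) (y.2 a) ∂P = ∫ a, β u a * β v a ∂P := by
        refine integral_congr_ae ?_
        filter_upwards [hu', hv'] with a ha hb
        simp [ha, hb, mul_comm]
      rw [h1, h2, integral_brownian_mul hβ, integral_indicator measurableSet_Ioc]
      simp
    · intro y _; simp
    · intro x _; simp
    · intro x y z _ _ _ h1 h2; simp [inner_add_left, h1, h2]
    · intro x y z _ _ _ h1 h2; simp [inner_add_right, h1, h2]
    · intro r x y _ _ h; simp [real_inner_smul_left, h]
    · intro r x y _ _ h; simp [real_inner_smul_right, h]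
  rw [real_inner_self_eq_norm_sq, real_inner_self_eq_norm_sq] at key
  exact (sq_eq_sq₀ (norm_nonneg _) (norm_nonneg _)).1 key

/-- `J` is the Wiener integral over `[0,∞)` of `g` with respect to `β`. -/
def IsItoPair (P : Measure Ω) (β : ℝ≥0 → Ω → ℝ) (g : ℝ → ℝ) (J : Ω → ℝ) : Prop :=
  ∃ (hg : MemLp g 2 volume) (hJ : MemLp J 2 P), (hg.toLp g, hJ.toLp J) ∈ itoGraph P β

namespace IsItoPair

variable {g g' : ℝ → ℝ} {J J' : Ω → ℝ}

lemma eLpNorm_eq (hβ : IsPreBrownianReal β P) (h : IsItoPair P β g J) :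
    eLpNorm J 2 P = eLpNorm g 2 volume := by
  obtain ⟨hg, hJ, hm⟩ := h
  have := norm_eq_of_mem_itoGraph hβ hm
  rw [Lp.norm_toLp, Lp.norm_toLp] at this
  exact ((ENNReal.toReal_eq_toReal_iff' hg.2.ne hJ.2.ne).1 this).symm

lemma brownian (hβ : IsPreBrownianReal β P) (u : ℝ≥0) :
    IsItoPair P β ((Set.Ioc 0 (u : ℝ)).indicator (fun _ ↦ 1)) (β u) := by
  refine ⟨memLp_indicator_const 2 measurableSet_Ioc 1 (Or.inr (by simp)),
    memLp_two_brownian hβ u, ?_⟩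
  exact Submodule.le_topologicalClosure _ (Submodule.subset_span
    ⟨u, MemLp.coeFn_toLp (memLp_indicator_const 2 measurableSet_Ioc 1 (Or.inr (by simp))),
      MemLp.coeFn_toLp (memLp_two_brownian hβ u)⟩)

lemma add (h : IsItoPair P β g J) (h' : IsItoPair P β g' J') :
    IsItoPair P β (g + g') (J + J') := by
  obtain ⟨hg, hJ, hm⟩ := h
  obtain ⟨hg', hJ', hm'⟩ := h'
  exact ⟨hg.add hg', hJ.add hJ', by
    have h := add_mem hm hm'
    rwa [Prod.mk_add_mk, ← MemLp.toLp_add, ← MemLp.toLp_add] at h⟩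

lemma sub (h : IsItoPair P β g J) (h' : IsItoPair P β g' J') :
    IsItoPair P β (g - g') (J - J') := by
  obtain ⟨hg, hJ, hm⟩ := h
  obtain ⟨hg', hJ', hm'⟩ := h'
  exact ⟨hg.sub hg', hJ.sub hJ', by
    have h := sub_mem hm hm'
    rwa [Prod.mk_sub_mk, ← MemLp.toLp_sub, ← MemLp.toLp_sub] at h⟩

lemma const_smul (c : ℝ) (h : IsItoPair P β g J) : IsItoPair P β (c • g) (c • J) := by
  obtain ⟨hg, hJ, hm⟩ := h
  exact ⟨hg.const_smul c, hJ.const_smul c,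
    by
    have h := Submodule.smul_mem _ c hm
    rwa [Prod.smul_mk, ← MemLp.toLp_const_smul, ← MemLp.toLp_const_smul] at h⟩

lemma sum {ι : Type*} (s : Finset ι) {g : ι → ℝ → ℝ} {J : ι → Ω → ℝ}
    (h : ∀ i ∈ s, IsItoPair P β (g i) (J i)) :
    IsItoPair P β (∑ i ∈ s, g i) (∑ i ∈ s, J i) := by
  classical
  induction s using Finset.induction_on with
  | empty =>
    exact ⟨MemLp.zero, MemLp.zero, (itoGraph P β).zero_mem⟩
  | insert a s ha ih =>
    rw [Finset.sum_insert ha, Finset.sum_insert ha]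
    exact (h a (by simp)).add (ih fun i hi ↦ h i (by simp [hi]))

lemma of_tendsto {φ : ℕ → ℝ → ℝ} {K : ℕ → Ω → ℝ} (hφ : ∀ k, IsItoPair P β (φ k) (K k))
    (hg : MemLp g 2 volume) (hJ : MemLp J 2 P)
    (h1 : Tendsto (fun k ↦ eLpNorm (φ k - g) 2 volume) atTop (𝓝 0))
    (h2 : Tendsto (fun k ↦ eLpNorm (K k - J) 2 P) atTop (𝓝 0)) : IsItoPair P β g J := by
  refine ⟨hg, hJ, ?_⟩
  have t1 := (Lp.tendsto_Lp_iff_tendsto_eLpNorm'' φ (fun k ↦ (hφ k).1) g hg).2 h1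
  have t2 := (Lp.tendsto_Lp_iff_tendsto_eLpNorm'' K (fun k ↦ (hφ k).2.1) J hJ).2 h2
  exact (Submodule.isClosed_topologicalClosure _).mem_of_tendsto (t1.prodMk_nhds t2)
    (Eventually.of_forall fun k ↦ (hφ k).2.2)

end IsItoPair

lemma StepFunction.isItoPair (hβ : IsPreBrownianReal β P) (φ : StepFunction) (t : ℝ≥0) :
    IsItoPair P β ((Set.Ioc 0 (t : ℝ)).indicator φ.toFun) (φ.integral β t) := by
  have h := IsItoPair.sum (P := P) (β := β) (Finset.range φ.num)
    (g := fun k ↦ φ.val k • ((Set.Ioc 0 ((min (φ.time (k + 1)) t : ℝ≥0) : ℝ)).indicator (fun _ ↦ 1)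
      - (Set.Ioc 0 ((min (φ.time k) t : ℝ≥0) : ℝ)).indicator (fun _ ↦ 1)))
    (J := fun k ↦ φ.val k • (β (min (φ.time (k + 1)) t) - β (min (φ.time k) t)))
    (fun k _ ↦ ((IsItoPair.brownian hβ _).sub (IsItoPair.brownian hβ _)).const_smul _)
  convert h using 1
  · ext s
    rw [Finset.sum_apply]
    by_cases hs : s ∈ Set.Ioc 0 (t : ℝ)
    · rw [Set.indicator_of_mem hs, StepFunction.toFun]
      refine Finset.sum_congr rfl fun k _ ↦ ?_
      have hmono : (φ.time k : ℝ) ≤ φ.time (k + 1) := by exact_mod_cast φ.monotone_time k.le_succ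
      obtain ⟨h0, h1⟩ := hs
      simp only [Set.indicator, Pi.smul_apply, Pi.sub_apply, Set.mem_Ioc, NNReal.coe_min,
        smul_eq_mul, le_min_iff, h0, h1, true_and, and_true]
      -- On `(0,t]` the difference of the two truncated indicators is the indicator of `(time k,
      -- time (k+1)]`.
      by_cases h2 : s ≤ φ.time k
      · have h3 : s ≤ φ.time (k + 1) := h2.trans hmono
        simp [h2, h3, not_lt.2 h2]
      · simp [h2, not_le.1 h2]
    · rw [Set.indicator_of_notMem hs]
      symm
      refine Finset.sum_eq_zero fun k _ ↦ ?_
      rw [Set.mem_Ioc] at hs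
      have (u : ℝ≥0) : (Set.Ioc 0 ((min u t : ℝ≥0) : ℝ)).indicator (fun _ ↦ (1 : ℝ)) s = 0 := by
        refine Set.indicator_of_notMem (fun h ↦ hs ⟨h.1, h.2.trans ?_⟩) _
        simp
      rw [Pi.smul_apply, Pi.sub_apply, this, this, sub_zero, smul_zero]
  · ext ω
    simp [StepFunction.integral]

/-- Extending integrands by zero outside `(0,t]` puts integrals over different horizons into one
graph, so that increments become differences of its elements. -/
lemma HasItoIntegral.isItoPair (hβ : IsPreBrownianReal β P) {f : ℝ → ℝ} {t : ℝ≥0} {I : Ω → ℝ}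
    (h : HasItoIntegral P β f t I) :
    IsItoPair P β ((Set.Ioc 0 (t : ℝ)).indicator f) I := by
  obtain ⟨hf, hI, φ, h1, h2⟩ := h
  refine IsItoPair.of_tendsto (fun k ↦ (φ k).isItoPair hβ t)
    ((memLp_indicator_iff_restrict measurableSet_Ioc).2 hf) hI ?_ h2
  refine h1.congr fun k ↦ ?_
  rw [← eLpNorm_indicator_eq_eLpNorm_restrict measurableSet_Ioc]
  congr 1
  ext s
  by_cases hs : s ∈ Set.Ioc 0 (t : ℝ) <;> simp [Set.indicator, hs]

/-- Itô isometry for the increments of a Wiener integral. -/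
lemma HasItoIntegral.eLpNorm_increment_sub (hβ : IsPreBrownianReal β P) {f : ℝ → ℝ} {s t : ℝ≥0}
    (hst : s ≤ t) {I I' : Ω → ℝ} (h : HasItoIntegral P β f t I) (h' : HasItoIntegral P β f s I')
    (c : ℝ) :
    eLpNorm (fun ω ↦ (I ω - I' ω) - c * (β t ω - β s ω)) 2 P =
      eLpNorm (fun r ↦ f r - c) 2 (volume.restrict (Set.Ioc (s : ℝ) t)) := by
  have hp := ((h.isItoPair hβ).sub (h'.isItoPair hβ)).sub
    (((IsItoPair.brownian hβ t).sub (IsItoPair.brownian hβ s)).const_smul c)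
  have := hp.eLpNorm_eq hβ
  rw [← eLpNorm_indicator_eq_eLpNorm_restrict measurableSet_Ioc]
  refine this.trans (congrArg (eLpNorm · 2 volume) ?_)
  ext r
  have hst' : (s : ℝ) ≤ t := by exact_mod_cast hst
  by_cases h0 : 0 < r
  · by_cases h1 : r ≤ s
    · have h2 : r ≤ t := h1.trans hst'
      simp [Set.indicator, h0, h1, h2, not_lt.2 h1]
    · by_cases h2 : r ≤ t <;> simp [Set.indicator, h0, h1, h2, not_le.1 h1]
  · have : ¬ (s : ℝ) < r := fun h ↦ h0 (s.2.trans_lt h)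
    simp [Set.indicator, h0, this]

lemma HasItoIntegral.memLp_two {f : ℝ → ℝ} {t : ℝ≥0} {I : Ω → ℝ}
    (h : HasItoIntegral P β f t I) : MemLp I 2 P := h.2.1

end Filtering

/-! ### Compensated products of Brownian increments. -/

namespace Filtering

variable {Ω : Type*} [MeasurableSpace Ω] {P : Measure Ω} {β γ : ℝ≥0 → Ω → ℝ}

/-- `β` and `γ` have cross variation `δ t`, in the sense that the compensated products of their
increments over disjoint intervals are orthogonal, with the variance scaling of Brownian motion. -/
structure HasCrossVariation (P : Measure Ω) (β γ : ℝ≥0 → Ω → ℝ) (δ C : ℝ) : Prop where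
  memLp : ∀ s t, MemLp (fun ω ↦ (β t ω - β s ω) * (γ t ω - γ s ω)) 2 P
  orthogonal : ∀ s t u v : ℝ≥0, s ≤ t → t ≤ u → u ≤ v →
    ∫ ω, ((β t ω - β s ω) * (γ t ω - γ s ω) - δ * (t - s)) *
      ((β v ω - β u ω) * (γ v ω - γ u ω) - δ * (v - u)) ∂P = 0
  integral_sq_le : ∀ s t : ℝ≥0, s ≤ t →
    ∫ ω, ((β t ω - β s ω) * (γ t ω - γ s ω) - δ * (t - s)) ^ 2 ∂P ≤ C * ((t : ℝ) - s) ^ 2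

lemma memLp_brownian_sub (hβ : IsPreBrownianReal β P) (s t : ℝ≥0) (p : ℝ≥0) :
    MemLp (fun ω ↦ β t ω - β s ω) p P := by
  have h := hβ.hasLaw_sub t s
  have h2 := memLp_id_gaussianReal (μ := 0) (v := nndist t.1 s.1) p
  rw [← h.map_eq] at h2
  exact (memLp_map_measure_iff aestronglyMeasurable_id h.aemeasurable).1 h2

lemma memLp_brownian_sub_mul_sub (hβ : IsPreBrownianReal β P) (hγ : IsPreBrownianReal γ P)
    (s t : ℝ≥0) : MemLp (fun ω ↦ (β t ω - β s ω) * (γ t ω - γ s ω)) 2 P := by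
  have : ENNReal.HolderTriple ((4 : ℝ≥0) : ℝ≥0∞) ((4 : ℝ≥0) : ℝ≥0∞) 2 := by
    constructor
    rw [← two_mul]
    have : (((4 : ℝ≥0) : ℝ≥0∞)) = 2 * 2 := by norm_num
    rw [this, ENNReal.mul_inv (by simp) (by simp), ← mul_assoc, ENNReal.mul_inv_cancel (by simp)
      (by simp), one_mul]
  exact (memLp_brownian_sub hγ s t 4).mul (memLp_brownian_sub hβ s t 4)

lemma integral_brownian_sub_mul_sub (hβ : IsPreBrownianReal β P) (s t u v : ℝ≥0) :
    ∫ ω, (β t ω - β s ω) * (β v ω - β u ω) ∂P =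
      min (t : ℝ) v - min (t : ℝ) u - min (s : ℝ) v + min (s : ℝ) u := by
  have hi (a b : ℝ≥0) : Integrable (fun ω ↦ β a ω * β b ω) P :=
    (memLp_two_brownian hβ a).integrable_mul (memLp_two_brownian hβ b)
  have : (fun ω ↦ (β t ω - β s ω) * (β v ω - β u ω)) = fun ω ↦
      β t ω * β v ω - β t ω * β u ω - β s ω * β v ω + β s ω * β u ω := by
    ext ω; ring
  have h1 : Integrable (fun ω ↦ β t ω * β v ω - β t ω * β u ω) P := (hi _ _).sub (hi _ _)
  have h2 : Integrable (fun ω ↦ β t ω * β v ω - β t ω * β u ω - β s ω * β v ω) P :=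
    h1.sub (hi _ _)
  rw [this, integral_add h2 (hi _ _), integral_sub h1 (hi _ _), integral_sub (hi _ _) (hi _ _)]
  simp only [integral_brownian_mul hβ]

lemma integral_brownian_sub_sq (hβ : IsPreBrownianReal β P) {s t : ℝ≥0} (hst : s ≤ t) :
    ∫ ω, (β t ω - β s ω) ^ 2 ∂P = t - s := by
  have hst' : (s : ℝ) ≤ t := by exact_mod_cast hst
  simp_rw [sq]
  rw [integral_brownian_sub_mul_sub hβ, min_self, min_self, min_eq_left hst', min_eq_right hst']
  ring

lemma integral_brownian_sub_mul_sub_of_disjoint (hβ : IsPreBrownianReal β P) {s t u v : ℝ≥0}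
    (hst : s ≤ t) (htu : t ≤ u) (huv : u ≤ v) :
    ∫ ω, (β t ω - β s ω) * (β v ω - β u ω) ∂P = 0 := by
  have hst' : (s : ℝ) ≤ t := by exact_mod_cast hst
  have htu' : (t : ℝ) ≤ u := by exact_mod_cast htu
  have huv' : (u : ℝ) ≤ v := by exact_mod_cast huv
  rw [integral_brownian_sub_mul_sub hβ, min_eq_left htu', min_eq_left (htu'.trans huv'),
    min_eq_left (hst'.trans htu'), min_eq_left ((hst'.trans htu').trans huv')]
  ring

/-- Brownian scaling: a centred Gaussian of variance `v` is `√v` times a standard one. This gives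
the quadratic bound in the length of the interval. -/
lemma integral_sq_sub_sq_gaussianReal (v : ℝ≥0) :
    ∫ x, (x * x - v) ^ 2 ∂(gaussianReal 0 v) =
      (∫ x, (x * x - 1) ^ 2 ∂(gaussianReal 0 1)) * (v : ℝ) ^ 2 := by
  have h : gaussianReal 0 v = (gaussianReal 0 1).map (fun x ↦ √v * x) := by
    rw [gaussianReal_map_const_mul]
    congr 1
    · simp
    · ext; simp
  rw [h, integral_map (by fun_prop) (by fun_prop), ← integral_mul_const]
  refine integral_congr_ae (.of_forall fun x ↦ ?_)
  have : √(v : ℝ) * √v = v := Real.mul_self_sqrt v.2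
  have h2 : √(v : ℝ) * x * (√v * x) - v = v * (x * x - 1) := by
    linear_combination (x * x) * this
  simp only [h2]
  ring

lemma HasCrossVariation.self (hβ : IsPreBrownianReal β P) :
    HasCrossVariation P β β 1 (∫ x, (x * x - 1) ^ 2 ∂(gaussianReal 0 1)) where
  memLp s t := memLp_brownian_sub_mul_sub hβ hβ s t
  orthogonal s t u v hst htu huv := by
    have : IsProbabilityMeasure P := hβ.isGaussianProcess.isProbabilityMeasure
    -- The four times form a monotone sequence, constant from index 3 on; its increments number 0
    -- and 2 are those over `[s,t]` and `[u,v]`.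
    have hmono : Monotone (fun k : ℕ ↦ if k = 0 then s else if k = 1 then t else
        if k = 2 then u else v) := by
      refine monotone_nat_of_le_succ fun k ↦ ?_
      match k with
      | 0 => simpa
      | 1 => simpa
      | 2 => simpa
      | k + 3 => simp
    have hind := (hβ.hasIndepIncrements.nat hmono).indepFun (show (0 : ℕ) ≠ 2 by simp)
    simp only [zero_add, one_ne_zero, if_true, if_false, OfNat.ofNat_ne_zero,
      OfNat.ofNat_ne_one, Nat.reduceAdd, Nat.reduceEqDiff] at hind
    have hind2 := hind.comp (φ := fun x : ℝ ↦ x * x - 1 * ((t : ℝ) - s))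
      (ψ := fun x : ℝ ↦ x * x - 1 * ((v : ℝ) - u))
      (by fun_prop) (by fun_prop)
    have hL (a b : ℝ≥0) : Integrable (fun ω ↦ (β b ω - β a ω) * (β b ω - β a ω)) P :=
      (memLp_brownian_sub_mul_sub hβ hβ a b).integrable (by norm_num)
    have key := hind2.integral_fun_mul_eq_mul_integral
      ((hL s t).sub (integrable_const _)).aestronglyMeasurable
      ((hL u v).sub (integrable_const _)).aestronglyMeasurable
    refine key.trans ?_
    have h0 : ∫ ω, ((β t ω - β s ω) * (β t ω - β s ω) - 1 * ((t : ℝ) - s)) ∂P = 0 := by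
      rw [integral_sub (hL s t) (integrable_const _)]
      simp_rw [← sq]
      rw [integral_brownian_sub_sq hβ hst]
      simp
    exact mul_eq_zero_of_left h0 _
  integral_sq_le s t hst := by
    have h := hβ.hasLaw_sub t s
    have hv : ((nndist t.1 s.1 : ℝ≥0) : ℝ) = t - s := by
      have : (s : ℝ) ≤ t := by exact_mod_cast hst
      rw [coe_nndist, Real.dist_eq, abs_of_nonneg]
      · rfl
      · exact sub_nonneg.2 this
    have h2 := h.integral_comp (f := fun x ↦ (x * x - (nndist t.1 s.1 : ℝ≥0)) ^ 2)
      (by fun_prop)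
    rw [integral_sq_sub_sq_gaussianReal, hv] at h2
    refine le_of_eq (Eq.trans ?_ h2)
    simp

/-- Only factorization of these mixed moments is needed, not independence itself. The `β` factor
vanishes on disjoint intervals, and on a single interval the two factors give `(t - s)²`, hence `C =
1`. -/
lemma HasCrossVariation.of_integral_mul (hβ : IsPreBrownianReal β P) (hγ : IsPreBrownianReal γ P)
    (h : ∀ s t u v, ∫ ω, ((β t ω - β s ω) * (β v ω - β u ω)) *
        ((γ t ω - γ s ω) * (γ v ω - γ u ω)) ∂P =
      (∫ ω, (β t ω - β s ω) * (β v ω - β u ω) ∂P) *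
        ∫ ω, (γ t ω - γ s ω) * (γ v ω - γ u ω) ∂P) :
    HasCrossVariation P β γ 0 1 where
  memLp s t := memLp_brownian_sub_mul_sub hβ hγ s t
  orthogonal s t u v hst htu huv := by
    have h1 := h s t u v
    rw [integral_brownian_sub_mul_sub_of_disjoint hβ hst htu huv, zero_mul] at h1
    exact (integral_congr_ae (.of_forall fun ω ↦ by ring)).trans h1
  integral_sq_le s t hst := by
    have h1 := h s t s t
    simp_rw [← sq] at h1
    rw [integral_brownian_sub_sq hβ hst, integral_brownian_sub_sq hγ hst, ← sq] at h1
    rw [one_mul, ← h1]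
    exact (integral_congr_ae (.of_forall fun ω ↦ by ring)).le

lemma HasCrossVariation.of_indepFun (hβ : IsPreBrownianReal β P) (hγ : IsPreBrownianReal γ P)
    (h : IndepFun (fun ω t ↦ β t ω) (fun ω t ↦ γ t ω) P) :
    HasCrossVariation P β γ 0 1 := by
  refine .of_integral_mul hβ hγ fun s t u v ↦ ?_
  have h1 := h.comp (φ := fun x : ℝ≥0 → ℝ ↦ (x t - x s) * (x v - x u))
    (ψ := fun x : ℝ≥0 → ℝ ↦ (x t - x s) * (x v - x u)) (by fun_prop) (by fun_prop)
  have hm {α : ℝ≥0 → Ω → ℝ} (hα : IsPreBrownianReal α P) :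
      AEStronglyMeasurable (fun ω ↦ (α t ω - α s ω) * (α v ω - α u ω)) P :=
    (memLp_brownian_sub hα s t 2).1.mul (memLp_brownian_sub hα u v 2).1
  exact h1.integral_fun_mul_eq_mul_integral (hm hβ) (hm hγ)

lemma IsPreBrownianReal.comp_measurePreserving {Ω' : Type*} [MeasurableSpace Ω'] {Q : Measure Ω'}
    (hβ : IsPreBrownianReal β P) {φ : Ω' → Ω} (hφ : MeasurePreserving φ Q P) :
    IsPreBrownianReal (fun t ω ↦ β t (φ ω)) Q where
  hasLaw I := (hβ.hasLaw I).comp hφ.hasLaw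

/-- Here `β` and `γ` may be the same process: reading them on different factors of the product
destroys any correlation. This is why the covariation vanishes under the product law. -/
lemma HasCrossVariation.prod [IsProbabilityMeasure P] (hβ : IsPreBrownianReal β P)
    (hγ : IsPreBrownianReal γ P) :
    HasCrossVariation (P.prod P) (fun t ω ↦ β t ω.1) (fun t ω ↦ γ t ω.2) 0 1 := by
  have h1 : MeasurePreserving Prod.fst (P.prod P) P := measurePreserving_fst
  have h2 : MeasurePreserving Prod.snd (P.prod P) P := measurePreserving_snd
  refine .of_integral_mul (IsPreBrownianReal.comp_measurePreserving hβ h1)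
    (IsPreBrownianReal.comp_measurePreserving hγ h2) fun s t u v ↦ ?_
  rw [integral_prod_mul (fun ω ↦ (β t ω - β s ω) * (β v ω - β u ω))
    (fun ω ↦ (γ t ω - γ s ω) * (γ v ω - γ u ω))]
  congr 1
  · rw [integral_fun_fst (fun ω ↦ (β t ω - β s ω) * (β v ω - β u ω))]
    simp
  · rw [integral_fun_snd (fun ω ↦ (γ t ω - γ s ω) * (γ v ω - γ u ω))]
    simp

lemma HasItoIntegral.comp_measurePreserving {Ω' : Type*} [MeasurableSpace Ω'] {Q : Measure Ω'}
    {f : ℝ → ℝ} {t : ℝ≥0} {I : Ω → ℝ} (hβ : IsPreBrownianReal β P)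
    (h : HasItoIntegral P β f t I) {φ : Ω' → Ω} (hφ : MeasurePreserving φ Q P) :
    HasItoIntegral Q (fun t ω ↦ β t (φ ω)) f t (fun ω ↦ I (φ ω)) := by
  obtain ⟨hf, hI, ψ, h1, h2⟩ := h
  refine ⟨hf, hI.comp_measurePreserving hφ, ψ, h1, h2.congr fun k ↦ ?_⟩
  exact (eLpNorm_comp_measurePreserving
    ((((ψ k).isItoPair hβ t).2.1.sub hI).1) hφ).symm

end Filtering

/-! ### The basic estimate for covariation sums. -/

namespace Filtering

variable {Ω : Type*} [MeasurableSpace Ω] {P : Measure Ω} {β γ : ℝ≥0 → Ω → ℝ} {δ C : ℝ}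

section SecondMoments

variable {α : Type*} [MeasurableSpace α] {μ : Measure α} {f g : α → ℝ}

lemma integral_abs_mul_le_sqrt_mul_sqrt (hf : MemLp f 2 μ) (hg : MemLp g 2 μ) :
    ∫ a, |f a * g a| ∂μ ≤ √(∫ a, f a ^ 2 ∂μ) * √(∫ a, g a ^ 2 ∂μ) := by
  have h := integral_mul_norm_le_Lp_mul_Lq (μ := μ) (f := f) (g := g)
    Real.HolderConjugate.two_two (by simpa using hf) (by simpa using hg)
  simpa [Real.sqrt_eq_rpow, abs_mul] using h

lemma integral_abs_le_sqrt [IsProbabilityMeasure μ] (hf : MemLp f 2 μ) :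
    ∫ a, |f a| ∂μ ≤ √(∫ a, f a ^ 2 ∂μ) := by
  simpa using integral_abs_mul_le_sqrt_mul_sqrt hf (memLp_const (μ := μ) (p := 2) (1 : ℝ))

lemma integral_sq_eq_toReal_eLpNorm (hf : MemLp f 2 μ) :
    ∫ a, f a ^ 2 ∂μ = (eLpNorm f 2 μ).toReal ^ 2 := by
  rw [hf.eLpNorm_eq_integral_rpow_norm (by simp) (by simp), ENNReal.toReal_ofReal (by positivity)]
  have h0 : 0 ≤ ∫ a, f a ^ 2 ∂μ := integral_nonneg fun a ↦ sq_nonneg _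
  simp only [ENNReal.toReal_ofNat, Real.rpow_ofNat, Real.norm_eq_abs, sq_abs]
  rw [← Real.rpow_natCast, ← Real.rpow_mul h0]
  simp

lemma integral_sq_sum_of_orthogonal {ι : Type*} (s : Finset ι) {Z : ι → α → ℝ}
    (hZ : ∀ i ∈ s, MemLp (Z i) 2 μ)
    (horth : ∀ i ∈ s, ∀ j ∈ s, i ≠ j → ∫ a, Z i a * Z j a ∂μ = 0) :
    ∫ a, (∑ i ∈ s, Z i a) ^ 2 ∂μ = ∑ i ∈ s, ∫ a, Z i a ^ 2 ∂μ := by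
  have hint : ∀ i ∈ s, ∀ j ∈ s, Integrable (fun a ↦ Z i a * Z j a) μ :=
    fun i hi j hj ↦ (hZ i hi).integrable_mul (hZ j hj)
  simp_rw [sq, Finset.sum_mul_sum]
  rw [integral_finsetSum _ fun i hi ↦ integrable_finsetSum _ fun j hj ↦ hint i hi j hj]
  refine Finset.sum_congr rfl fun i hi ↦ ?_
  rw [integral_finsetSum _ fun j hj ↦ hint i hi j hj]
  exact Finset.sum_eq_single_of_mem i hi fun j hj hji ↦ horth i hi j hj hji.symm

end SecondMoments

lemma HasCrossVariation.nonneg (h : HasCrossVariation P β γ δ C) : 0 ≤ C := by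
  have h1 := h.integral_sq_le 0 1 zero_le_one
  have h2 : 0 ≤ ∫ ω, ((β 1 ω - β 0 ω) * (γ 1 ω - γ 0 ω) - δ * (((1 : ℝ≥0) : ℝ) - (0 : ℝ≥0))) ^ 2 ∂P :=
    integral_nonneg fun _ ↦ sq_nonneg _
  simpa using h2.trans h1

/-- Pythagoras for the orthogonal compensated products. For bounded `c` the bound is of the order of
the mesh. -/
lemma HasCrossVariation.integral_sq_sum_le [IsProbabilityMeasure P]
    (h : HasCrossVariation P β γ δ C) {τ : ℕ → ℝ≥0} (hτ : Monotone τ) (c : ℕ → ℝ) (N : ℕ) :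
    MemLp (fun ω ↦ ∑ k ∈ Finset.range N, c k * ((β (τ (k + 1)) ω - β (τ k) ω) *
        (γ (τ (k + 1)) ω - γ (τ k) ω) - δ * (τ (k + 1) - τ k))) 2 P ∧
    ∫ ω, (∑ k ∈ Finset.range N, c k * ((β (τ (k + 1)) ω - β (τ k) ω) *
        (γ (τ (k + 1)) ω - γ (τ k) ω) - δ * (τ (k + 1) - τ k))) ^ 2 ∂P ≤
      C * ∑ k ∈ Finset.range N, c k ^ 2 * ((τ (k + 1) : ℝ) - τ k) ^ 2 := by
  have hL (k : ℕ) : MemLp (fun ω ↦ c k * ((β (τ (k + 1)) ω - β (τ k) ω) *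
        (γ (τ (k + 1)) ω - γ (τ k) ω) - δ * (τ (k + 1) - τ k))) 2 P :=
    ((h.memLp _ _).sub (memLp_const _)).const_mul _
  refine ⟨memLp_finsetSum _ fun k _ ↦ hL k, ?_⟩
  have horth : ∀ k l : ℕ, k < l → ∫ ω, (c k * ((β (τ (k + 1)) ω - β (τ k) ω) *
        (γ (τ (k + 1)) ω - γ (τ k) ω) - δ * (τ (k + 1) - τ k))) *
      (c l * ((β (τ (l + 1)) ω - β (τ l) ω) *
        (γ (τ (l + 1)) ω - γ (τ l) ω) - δ * (τ (l + 1) - τ l))) ∂P = 0 := by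
    intro k l hkl
    have h1 := h.orthogonal (τ k) (τ (k + 1)) (τ l) (τ (l + 1)) (hτ k.le_succ) (hτ hkl)
      (hτ l.le_succ)
    have h2 := congrArg ((c k * c l) * ·) h1
    simp only [mul_zero] at h2
    rw [← integral_const_mul] at h2
    exact (integral_congr_ae (.of_forall fun ω ↦ by ring)).trans h2
  rw [integral_sq_sum_of_orthogonal _ fun k _ ↦ hL k, Finset.mul_sum]
  · refine Finset.sum_le_sum fun k _ ↦ ?_
    simp_rw [mul_pow]
    rw [integral_const_mul]
    calc _ ≤ c k ^ 2 * (C * ((τ (k + 1) : ℝ) - τ k) ^ 2) :=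
          mul_le_mul_of_nonneg_left (h.integral_sq_le _ _ (hτ k.le_succ)) (sq_nonneg _)
      _ = _ := by ring
  · intro k _ l _ hkl
    rcases hkl.lt_or_gt with hlt | hlt
    · exact horth k l hlt
    · rw [← horth l k hlt]
      exact integral_congr_ae (.of_forall fun ω ↦ mul_comm _ _)

lemma HasItoIntegral.memLp_increment_sub (hβ : IsPreBrownianReal β P) {f : ℝ → ℝ} {s t : ℝ≥0}
    {I I' : Ω → ℝ} (h : HasItoIntegral P β f t I) (h' : HasItoIntegral P β f s I') (c : ℝ) :
    MemLp (fun ω ↦ (I ω - I' ω) - c * (β t ω - β s ω)) 2 P :=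
  (h.memLp_two.sub h'.memLp_two).sub
    (((memLp_two_brownian hβ t).sub (memLp_two_brownian hβ s)).const_mul c)

lemma HasItoIntegral.memLp_sub_const {f : ℝ → ℝ} {s t : ℝ≥0} {I : Ω → ℝ}
    (h : HasItoIntegral P β f t I) (c : ℝ) :
    MemLp (fun r ↦ f r - c) 2 (volume.restrict (Set.Ioc (s : ℝ) t)) :=
  (h.1.mono_measure (Measure.restrict_mono (Set.Ioc_subset_Ioc_left s.2) le_rfl)).sub
    (memLp_const c)

lemma HasItoIntegral.integral_sq_increment_sub (hβ : IsPreBrownianReal β P) {f : ℝ → ℝ}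
    {s t : ℝ≥0} (hst : s ≤ t) {I I' : Ω → ℝ} (h : HasItoIntegral P β f t I)
    (h' : HasItoIntegral P β f s I') (c : ℝ) :
    ∫ ω, ((I ω - I' ω) - c * (β t ω - β s ω)) ^ 2 ∂P = ∫ r in (s : ℝ)..t, (f r - c) ^ 2 := by
  rw [integral_sq_eq_toReal_eLpNorm (h.memLp_increment_sub hβ h' c),
    h.eLpNorm_increment_sub hβ hst h', intervalIntegral.integral_of_le (by exact_mod_cast hst),
    integral_sq_eq_toReal_eLpNorm (h.memLp_sub_const c)]

/-- The error made by approximating a sum of products of increments of a Wiener integral and of a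
Brownian motion, in terms of the distance of the integrand to a step function. -/
lemma integral_abs_sum_increments_sub_le (hβ : IsPreBrownianReal β P)
    (hγ : IsPreBrownianReal γ P) (hX : HasCrossVariation P β γ δ C) {f : ℝ → ℝ}
    {τ : ℕ → ℝ≥0} (hτ : Monotone τ) {N : ℕ} {I : ℕ → Ω → ℝ}
    (hI : ∀ k ≤ N, HasItoIntegral P β f (τ k) (I k)) (c : ℕ → ℝ) :
    ∫ ω, |∑ k ∈ Finset.range N, (I (k + 1) ω - I k ω) * (γ (τ (k + 1)) ω - γ (τ k) ω) -
        δ * ∫ r in (τ 0 : ℝ)..τ N, f r| ∂P ≤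
      (1 + |δ|) * (√(∑ k ∈ Finset.range N, ∫ r in (τ k : ℝ)..τ (k + 1), (f r - c k) ^ 2) *
        √((τ N : ℝ) - τ 0)) +
      √(C * ∑ k ∈ Finset.range N, c k ^ 2 * ((τ (k + 1) : ℝ) - τ k) ^ 2) := by
  have : IsProbabilityMeasure P := hβ.isGaussianProcess.isProbabilityMeasure
  have hle (k : ℕ) : (τ k : ℝ) ≤ τ (k + 1) := by exact_mod_cast hτ k.le_succ
  have hsumτ : ∑ k ∈ Finset.range N, ((τ (k + 1) : ℝ) - τ k) = τ N - τ 0 :=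
    Finset.sum_range_sub (fun k ↦ (τ k : ℝ)) N
  have hI1 : ∀ k ∈ Finset.range N, HasItoIntegral P β f (τ (k + 1)) (I (k + 1)) :=
    fun k hk ↦ hI _ (Finset.mem_range.1 hk)
  have hI0 : ∀ k ∈ Finset.range N, HasItoIntegral P β f (τ k) (I k) :=
    fun k hk ↦ hI _ (Finset.mem_range.1 hk).le
  set D : ℕ → ℝ := fun k ↦ ∫ r in (τ k : ℝ)..τ (k + 1), (f r - c k) ^ 2 with hD
  have hD0 (k : ℕ) : 0 ≤ D k := intervalIntegral.integral_nonneg (hle k) fun _ _ ↦ sq_nonneg _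
  have hCS : ∑ k ∈ Finset.range N, √(D k) * √((τ (k + 1) : ℝ) - τ k) ≤
      √(∑ k ∈ Finset.range N, D k) * √((τ N : ℝ) - τ 0) := by
    rw [← hsumτ]
    exact Real.sum_sqrt_mul_sqrt_le _ hD0 fun k ↦ sub_nonneg.2 (hle k)
  -- replacing the increments of the Wiener integral by those of the step function
  set a : ℕ → Ω → ℝ := fun k ω ↦
    ((I (k + 1) ω - I k ω) - c k * (β (τ (k + 1)) ω - β (τ k) ω)) *
      (γ (τ (k + 1)) ω - γ (τ k) ω) with ha
  have ha_int : ∀ k ∈ Finset.range N, Integrable (a k) P := fun k hk ↦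
    ((hI1 k hk).memLp_increment_sub hβ (hI0 k hk) (c k)).integrable_mul
      ((memLp_two_brownian hγ _).sub (memLp_two_brownian hγ _))
  have hA : ∫ ω, |∑ k ∈ Finset.range N, a k ω| ∂P ≤
      √(∑ k ∈ Finset.range N, D k) * √((τ N : ℝ) - τ 0) := by
    calc ∫ ω, |∑ k ∈ Finset.range N, a k ω| ∂P
        ≤ ∫ ω, ∑ k ∈ Finset.range N, |a k ω| ∂P :=
          integral_mono (integrable_finsetSum _ ha_int).abs
            (integrable_finsetSum _ fun k hk ↦ (ha_int k hk).abs)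
            fun ω ↦ Finset.abs_sum_le_sum_abs _ _
      _ = ∑ k ∈ Finset.range N, ∫ ω, |a k ω| ∂P :=
          integral_finsetSum _ fun k hk ↦ (ha_int k hk).abs
      _ ≤ ∑ k ∈ Finset.range N, √(D k) * √((τ (k + 1) : ℝ) - τ k) := by
          refine Finset.sum_le_sum fun k hk ↦ ?_
          refine (integral_abs_mul_le_sqrt_mul_sqrt
            ((hI1 k hk).memLp_increment_sub hβ (hI0 k hk) (c k))
            ((memLp_two_brownian hγ (τ (k + 1))).sub (memLp_two_brownian hγ (τ k)))).trans_eq ?_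
          rw [(hI1 k hk).integral_sq_increment_sub hβ (hτ k.le_succ) (hI0 k hk) (c k)]
          congr 2
          exact integral_brownian_sub_sq hγ (hτ k.le_succ)
      _ ≤ _ := hCS
  -- the compensated sum for the step function
  obtain ⟨hBL, hB⟩ := hX.integral_sq_sum_le hτ c N
  set b : Ω → ℝ := fun ω ↦ ∑ k ∈ Finset.range N, c k * ((β (τ (k + 1)) ω - β (τ k) ω) *
        (γ (τ (k + 1)) ω - γ (τ k) ω) - δ * (τ (k + 1) - τ k)) with hb
  have hB' := (integral_abs_le_sqrt hBL).trans (Real.sqrt_le_sqrt hB)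
  -- the integral of the step function
  have hint : ∀ k ∈ Finset.range N, IntervalIntegrable (fun r ↦ f r - c k) volume
      (τ k : ℝ) (τ (k + 1)) := fun k hk ↦
    (intervalIntegrable_iff_integrableOn_Ioc_of_le (hle k)).2
      (((hI1 k hk).memLp_sub_const (c k)).integrable (by norm_num))
  have hE : |∑ k ∈ Finset.range N, c k * ((τ (k + 1) : ℝ) - τ k) - ∫ r in (τ 0 : ℝ)..τ N, f r| ≤
      √(∑ k ∈ Finset.range N, D k) * √((τ N : ℝ) - τ 0) := by
    have hfi : ∀ k ∈ Finset.range N, IntervalIntegrable f volume (τ k : ℝ) (τ (k + 1)) := by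
      intro k hk
      simpa using (hint k hk).add (intervalIntegrable_const (c := c k))
    rw [← intervalIntegral.sum_integral_adjacent_intervals (a := fun k ↦ (τ k : ℝ))
      fun k hk ↦ hfi k (Finset.mem_range.2 hk), ← Finset.sum_sub_distrib]
    refine (Finset.abs_sum_le_sum_abs _ _).trans (le_trans (Finset.sum_le_sum fun k hk ↦ ?_) hCS)
    have h1 : c k * ((τ (k + 1) : ℝ) - τ k) - ∫ r in (τ k : ℝ)..τ (k + 1), f r =
        - ∫ r in (τ k : ℝ)..τ (k + 1), (f r - c k) := by
      rw [intervalIntegral.integral_sub (hfi k hk) intervalIntegrable_const]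
      simp [mul_comm]
    rw [h1, abs_neg]
    refine (intervalIntegral.abs_integral_le_integral_abs (hle k)).trans ?_
    have h2 := integral_abs_mul_le_sqrt_mul_sqrt ((hI1 k hk).memLp_sub_const (s := τ k) (c k))
      (memLp_const (1 : ℝ))
    rw [hD]
    dsimp only
    rw [intervalIntegral.integral_of_le (hle k), intervalIntegral.integral_of_le (hle k)]
    simpa [max_eq_left (sub_nonneg.2 (hle k))] using h2
  -- The error splits into replacing `f` by the step function in the Wiener integral, the
  -- compensated sum, and `δ` times the error in `∫ f`. The first and third obey the same bound,
  -- whence the factor `1 + |δ|`.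
  have hdecomp (ω : Ω) : ∑ k ∈ Finset.range N, (I (k + 1) ω - I k ω) *
        (γ (τ (k + 1)) ω - γ (τ k) ω) - δ * ∫ r in (τ 0 : ℝ)..τ N, f r =
      ∑ k ∈ Finset.range N, a k ω + b ω + δ * (∑ k ∈ Finset.range N,
        c k * ((τ (k + 1) : ℝ) - τ k) - ∫ r in (τ 0 : ℝ)..τ N, f r) := by
    rw [ha, hb, mul_sub δ, Finset.mul_sum, ← add_sub_assoc, ← Finset.sum_add_distrib,
      ← Finset.sum_add_distrib]
    congr 1
    refine Finset.sum_congr rfl fun k _ ↦ ?_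
    ring
  have hAi : Integrable (fun ω ↦ |∑ k ∈ Finset.range N, a k ω|) P :=
    (integrable_finsetSum _ ha_int).abs
  have hBi : Integrable (fun ω ↦ |b ω|) P := (hBL.integrable (by norm_num)).abs
  set e := |∑ k ∈ Finset.range N, c k * ((τ (k + 1) : ℝ) - τ k) - ∫ r in (τ 0 : ℝ)..τ N, f r|
    with he
  calc _ ≤ ∫ ω, (|∑ k ∈ Finset.range N, a k ω| + |b ω| + |δ| * e) ∂P := by
        refine integral_mono_of_nonneg (.of_forall fun _ ↦ abs_nonneg _)
          ((hAi.add hBi).add (integrable_const _)) (.of_forall fun ω ↦ ?_)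
        dsimp only
        rw [hdecomp ω, he, ← abs_mul]
        exact abs_add_three _ _ _
    _ = ∫ ω, |∑ k ∈ Finset.range N, a k ω| ∂P + ∫ ω, |b ω| ∂P + |δ| * e := by
        have hABi : Integrable (fun ω ↦ |∑ k ∈ Finset.range N, a k ω| + |b ω|) P := hAi.add hBi
        rw [integral_add hABi (integrable_const _), integral_add hAi hBi]
        simp
    _ ≤ _ := by
        have := mul_le_mul_of_nonneg_left hE (abs_nonneg δ)
        linarith

end Filtering

/-! ### Uniform grids and limits along them. -/

namespace Filtering

/-- The `k`-th point of the partition of `[0,T]` into `m` intervals of equal length. -/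
noncomputable def gridTime (T : ℝ≥0) (m k : ℕ) : ℝ≥0 := T * (k / m)

lemma gridTime_monotone (T : ℝ≥0) (m : ℕ) : Monotone (gridTime T m) := fun k l hkl ↦ by
  unfold gridTime
  gcongr

@[simp] lemma gridTime_zero (T : ℝ≥0) (m : ℕ) : gridTime T m 0 = 0 := by simp [gridTime]

lemma gridTime_self (T : ℝ≥0) {m : ℕ} (hm : m ≠ 0) : gridTime T m m = T := by
  have : (m : ℝ≥0) ≠ 0 := by exact_mod_cast hm
  simp [gridTime, div_self this]

lemma gridTime_le (T : ℝ≥0) {m k : ℕ} (hk : k ≤ m) : gridTime T m k ≤ T := by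
  rcases eq_or_ne m 0 with rfl | hm
  · simp [gridTime]
  · exact (gridTime_monotone T m hk).trans_eq (gridTime_self T hm)

lemma gridTime_succ_sub (T : ℝ≥0) (m k : ℕ) :
    (gridTime T m (k + 1) : ℝ) - gridTime T m k = T / m := by
  simp only [gridTime, NNReal.coe_mul, NNReal.coe_div, NNReal.coe_natCast]
  push_cast
  ring

lemma gridTime_le_gridTime_succ (T : ℝ≥0) (m k : ℕ) :
    (gridTime T m k : ℝ) ≤ gridTime T m (k + 1) := by
  exact_mod_cast gridTime_monotone T m k.le_succ

lemma gridTime_mem_Icc (T : ℝ≥0) {m k : ℕ} (hk : k ≤ m) :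
    (gridTime T m k : ℝ) ∈ Set.Icc (0 : ℝ) T :=
  ⟨(gridTime T m k).2, by exact_mod_cast gridTime_le T hk⟩

lemma eventually_dist_gridTime_lt (T : ℝ≥0) {d : ℝ} (hd : 0 < d) :
    ∀ᶠ m : ℕ in atTop, (T : ℝ) / m < d := by
  have := tendsto_const_div_atTop_nhds_zero_nat (T : ℝ)
  exact this.eventually (gt_mem_nhds hd)

lemma sum_integral_gridTime (T : ℝ≥0) {m : ℕ} (hm : m ≠ 0) {g : ℝ → ℝ}
    (hg : IntervalIntegrable g volume 0 T) :
    ∑ k ∈ Finset.range m, ∫ r in (gridTime T m k : ℝ)..gridTime T m (k + 1), g r =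
      ∫ r in (0 : ℝ)..T, g r := by
  rw [intervalIntegral.sum_integral_adjacent_intervals (a := fun k ↦ (gridTime T m k : ℝ)),
    gridTime_zero, gridTime_self T hm, NNReal.coe_zero]
  intro k hk
  refine hg.mono_set ?_
  rw [Set.uIcc_of_le (gridTime_le_gridTime_succ T m k), Set.uIcc_of_le (NNReal.coe_nonneg T)]
  exact Set.Icc_subset_Icc (gridTime_mem_Icc T hk.le).1 (gridTime_mem_Icc T hk).2

/-- Approximate `f` in `L²` by a continuous function of compact support and sample that at the left
grid points. The bound `M` does not depend on `m`, so the compensated sums vanish as the mesh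
shrinks. -/
lemma exists_step_approx {T : ℝ≥0} {f : ℝ → ℝ}
    (hf : MemLp f 2 (volume.restrict (Set.Ioc 0 (T : ℝ)))) {ε : ℝ} (hε : 0 < ε) :
    ∃ M : ℝ, ∀ᶠ m : ℕ in atTop, ∃ c : ℕ → ℝ, (∀ k, |c k| ≤ M) ∧
      ∑ k ∈ Finset.range m,
        ∫ r in (gridTime T m k : ℝ)..gridTime T m (k + 1), (f r - c k) ^ 2 ≤ ε := by
  -- By `(x + y)² ≤ 2x² + 2y²` the total error is at most `2(η² + η² T)`: an `L²` error `η` for `g`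
  -- and an oscillation `η` of `g` on each cell.
  set η : ℝ := √(ε / (2 * (1 + T))) with hη
  have hT : (0 : ℝ) ≤ T := T.2
  have hη0 : 0 < η := Real.sqrt_pos.2 (by positivity)
  have hη2 : 2 * (η ^ 2 + η ^ 2 * T) = ε := by
    rw [hη, Real.sq_sqrt (by positivity)]
    field_simp
  obtain ⟨g, hgc, hgη, hgcont, hgL⟩ := hf.exists_hasCompactSupport_eLpNorm_sub_le (by simp)
    (ε := ENNReal.ofReal η) (by simpa using hη0)
  have hfg : ∫ r in (0 : ℝ)..T, (f r - g r) ^ 2 ≤ η ^ 2 := by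
    rw [intervalIntegral.integral_of_le hT]
    refine (integral_sq_eq_toReal_eLpNorm (hf.sub hgL)).trans_le ?_
    exact pow_le_pow_left₀ ENNReal.toReal_nonneg (ENNReal.toReal_le_of_le_ofReal hη0.le hgη) 2
  have hfgi : IntervalIntegrable (fun r ↦ (f r - g r) ^ 2) volume 0 T :=
    (intervalIntegrable_iff_integrableOn_Ioc_of_le hT).2 (hf.sub hgL).integrable_sq
  obtain ⟨M, hM⟩ := hgcont.bounded_above_of_compact_support hgc
  obtain ⟨d, hd, hgd⟩ := Metric.uniformContinuous_iff.1
    (hgc.uniformContinuous_of_continuous hgcont) η hη0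
  refine ⟨M, ?_⟩
  filter_upwards [eventually_dist_gridTime_lt T hd, eventually_ne_atTop 0] with m hmd hm0
  refine ⟨fun k ↦ g (gridTime T m k), fun k ↦ hM _, ?_⟩
  have hii : IntervalIntegrable (fun r ↦ 2 * ((f r - g r) ^ 2 + η ^ 2)) volume 0 T :=
    (hfgi.add intervalIntegrable_const).const_mul 2
  calc _ ≤ ∑ k ∈ Finset.range m, ∫ r in (gridTime T m k : ℝ)..gridTime T m (k + 1),
        2 * ((f r - g r) ^ 2 + η ^ 2) := by
        refine Finset.sum_le_sum fun k hk ↦ ?_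
        have hk' := Finset.mem_range.1 hk
        have hle := gridTime_le_gridTime_succ T m k
        rw [intervalIntegral.integral_of_le hle, intervalIntegral.integral_of_le hle]
        refine integral_mono_of_nonneg (.of_forall fun _ ↦ sq_nonneg _) ?_ ?_
        · refine ((intervalIntegrable_iff_integrableOn_Ioc_of_le hT).1 hii).mono_set ?_
          exact Set.Ioc_subset_Ioc (gridTime_mem_Icc T hk'.le).1 (gridTime_mem_Icc T hk').2
        · refine (ae_restrict_iff' measurableSet_Ioc).2 (.of_forall fun r hr ↦ ?_)
          have h1 : dist r (gridTime T m k) < d := by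
            rw [Real.dist_eq, abs_of_nonneg (sub_nonneg.2 hr.1.le)]
            have := gridTime_succ_sub T m k
            linarith [hr.2]
          have h2 := (hgd h1).le
          rw [Real.dist_eq] at h2
          have h3 : (g r - g (gridTime T m k)) ^ 2 ≤ η ^ 2 := by
            rw [← sq_abs]; exact pow_le_pow_left₀ (abs_nonneg _) h2 2
          dsimp only
          nlinarith [sq_nonneg ((f r - g r) - (g r - g (gridTime T m k)))]
    _ = 2 * (∫ r in (0 : ℝ)..T, (f r - g r) ^ 2) + 2 * (η ^ 2 * T) := by
        rw [sum_integral_gridTime T hm0 hii, intervalIntegral.integral_const_mul,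
          intervalIntegral.integral_add hfgi intervalIntegrable_const]
        simp
        ring
    _ ≤ ε := by linarith

variable {Ω : Type*} [MeasurableSpace Ω] {P : Measure Ω} {β γ : ℝ≥0 → Ω → ℝ} {δ C : ℝ}

/-- The covariation of a Wiener integral and a Brownian motion, as a limit in `L¹`. -/
lemma tendsto_integral_abs_sum_increments_sub (hβ : IsPreBrownianReal β P)
    (hγ : IsPreBrownianReal γ P) (hX : HasCrossVariation P β γ δ C) {f : ℝ → ℝ} {T : ℝ≥0}
    (hf : MemLp f 2 (volume.restrict (Set.Ioc 0 (T : ℝ)))) {I : ℕ → ℕ → Ω → ℝ}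
    (hI : ∀ m, ∀ k ≤ m, HasItoIntegral P β f (gridTime T m k) (I m k)) :
    Tendsto (fun m ↦ ∫ ω, |∑ k ∈ Finset.range m, (I m (k + 1) ω - I m k ω) *
        (γ (gridTime T m (k + 1)) ω - γ (gridTime T m k) ω) -
        δ * ∫ r in (0 : ℝ)..T, f r| ∂P) atTop (𝓝 0) := by
  have hT : (0 : ℝ) ≤ T := T.2
  refine Metric.tendsto_nhds.2 fun ε hε ↦ ?_
  -- With this `K` the approximation error costs at most `ε / 2`; the compensated sum takes the
  -- other half.
  set K : ℝ := (1 + |δ|) * √T + 1 with hK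
  have hK0 : 0 < K := by positivity
  obtain ⟨M, hM⟩ := exists_step_approx hf (ε := (ε / (2 * K)) ^ 2) (by positivity)
  have hlim : Tendsto (fun m : ℕ ↦ √(C * (M ^ 2 * T * (T / m)))) atTop (𝓝 0) := by
    have := (((tendsto_const_div_atTop_nhds_zero_nat (T : ℝ)).const_mul (M ^ 2 * T)).const_mul
      C).sqrt
    simpa using this
  filter_upwards [hM, hlim.eventually (gt_mem_nhds (half_pos hε)), eventually_ne_atTop 0]
    with m ⟨c, hcM, hc⟩ hm hm0
  have hm0' : (m : ℝ) ≠ 0 := by exact_mod_cast hm0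
  have h := integral_abs_sum_increments_sub_le hβ hγ hX (gridTime_monotone T m) (hI m) c
  rw [gridTime_zero, gridTime_self T hm0, NNReal.coe_zero, sub_zero] at h
  rw [Real.dist_eq, sub_zero, abs_of_nonneg (integral_nonneg fun _ ↦ abs_nonneg _)]
  refine h.trans_lt ?_
  have h1 : √(∑ k ∈ Finset.range m,
      ∫ r in (gridTime T m k : ℝ)..gridTime T m (k + 1), (f r - c k) ^ 2) ≤ ε / (2 * K) :=
    Real.sqrt_le_iff.2 ⟨by positivity, hc⟩
  have h2 : ∑ k ∈ Finset.range m, c k ^ 2 *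
      ((gridTime T m (k + 1) : ℝ) - gridTime T m k) ^ 2 ≤ M ^ 2 * T * (T / m) := by
    calc _ ≤ ∑ k ∈ Finset.range m, M ^ 2 * ((T : ℝ) / m) ^ 2 := by
          refine Finset.sum_le_sum fun k _ ↦ ?_
          rw [gridTime_succ_sub]
          refine mul_le_mul_of_nonneg_right ?_ (sq_nonneg _)
          rw [← sq_abs]
          exact pow_le_pow_left₀ (abs_nonneg _) (hcM k) 2
      _ = _ := by
          rw [Finset.sum_const, Finset.card_range, nsmul_eq_mul]
          field_simp
  have h3 := (Real.sqrt_le_sqrt (mul_le_mul_of_nonneg_left h2 hX.nonneg)).trans_lt hm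
  have h4 : (1 + |δ|) * (√(∑ k ∈ Finset.range m,
      ∫ r in (gridTime T m k : ℝ)..gridTime T m (k + 1), (f r - c k) ^ 2) * √T) ≤ ε / 2 := by
    calc _ ≤ (1 + |δ|) * (ε / (2 * K) * √T) := by gcongr
      _ = ε / (2 * K) * (K - 1) := by rw [hK]; ring
      _ ≤ ε / (2 * K) * K := by gcongr; linarith
      _ = ε / 2 := by field_simp
  linarith

/-- A path of finite variation has zero covariation with any continuous path. -/
lemma tendsto_sum_increments_mul_integral {T : ℝ≥0} {u q : ℝ → ℝ}
    (hu : ContinuousOn u (Set.Icc 0 T)) (hq : IntervalIntegrable q volume 0 T) :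
    Tendsto (fun m ↦ ∑ k ∈ Finset.range m, (u (gridTime T m (k + 1)) - u (gridTime T m k)) *
      ((∫ r in (0 : ℝ)..gridTime T m (k + 1), q r) - ∫ r in (0 : ℝ)..gridTime T m k, q r))
      atTop (𝓝 0) := by
  have hT : (0 : ℝ) ≤ T := T.2
  set A : ℝ := ∫ r in (0 : ℝ)..T, |q r| with hA
  have hA0 : 0 ≤ A := intervalIntegral.integral_nonneg hT fun _ _ ↦ abs_nonneg _
  refine Metric.tendsto_nhds.2 fun ε hε ↦ ?_
  obtain ⟨d, hd, hud⟩ := Metric.uniformContinuousOn_iff.1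
    (isCompact_Icc.uniformContinuousOn_of_continuous hu) (ε / (A + 1)) (by positivity)
  filter_upwards [eventually_dist_gridTime_lt T hd, eventually_ne_atTop 0] with m hmd hm0
  rw [Real.dist_eq, sub_zero]
  have hsub {k : ℕ} (hk : k ≤ m) : IntervalIntegrable q volume 0 (gridTime T m k) := by
    refine hq.mono_set ?_
    rw [Set.uIcc_of_le (gridTime_mem_Icc T hk).1, Set.uIcc_of_le hT]
    exact Set.Icc_subset_Icc_right (gridTime_mem_Icc T hk).2
  calc _ ≤ ∑ k ∈ Finset.range m, ε / (A + 1) *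
        ∫ r in (gridTime T m k : ℝ)..gridTime T m (k + 1), |q r| := by
        refine (Finset.abs_sum_le_sum_abs _ _).trans (Finset.sum_le_sum fun k hk ↦ ?_)
        have hk' := Finset.mem_range.1 hk
        rw [abs_mul, intervalIntegral.integral_interval_sub_left (hsub hk') (hsub hk'.le)]
        refine mul_le_mul ?_ (intervalIntegral.abs_integral_le_integral_abs
          (gridTime_le_gridTime_succ T m k)) (abs_nonneg _) (by positivity)
        refine (hud _ (gridTime_mem_Icc T hk') _ (gridTime_mem_Icc T hk'.le) ?_).le
        rw [Real.dist_eq, gridTime_succ_sub, abs_of_nonneg (by positivity)]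
        exact hmd
    _ = ε / (A + 1) * A := by rw [← Finset.mul_sum, sum_integral_gridTime T hm0 hq.abs]
    _ < ε / (A + 1) * (A + 1) := by gcongr; linarith
    _ = ε := by field_simp

end Filtering

/-! ### Covariation sums of paths with drift. -/

namespace Filtering

/-- The covariation sum of two paths along the partition of `[0,T]` into `m` equal intervals. -/
noncomputable def gridCovariation (T : ℝ≥0) (m : ℕ) (x y : ℝ → ℝ) : ℝ :=
  ∑ k ∈ Finset.range m, (x (gridTime T m (k + 1)) - x (gridTime T m k)) *
    (y (gridTime T m (k + 1)) - y (gridTime T m k))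

variable {Ω : Type*} [MeasurableSpace Ω] {P : Measure Ω} {ι : Type*} [Fintype ι]
  {β : ι → ℝ≥0 → Ω → ℝ} {γ : ℝ≥0 → Ω → ℝ} {δ : ι → ℝ}

/-- The covariation is linear in the signal noise: the `L¹` limits for the separate `β j` add up.
Convergence in measure is what allows extracting almost surely convergent subsequences. -/
lemma tendstoInMeasure_sum_increments (hβ : ∀ j, IsPreBrownianReal (β j) P)
    (hγ : IsPreBrownianReal γ P) (hX : ∀ j, ∃ C, HasCrossVariation P (β j) γ (δ j) C)
    {f : ι → ℝ → ℝ} {T : ℝ≥0}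
    (hf : ∀ j, MemLp (f j) 2 (volume.restrict (Set.Ioc 0 (T : ℝ)))) {I : ℝ≥0 → ι → Ω → ℝ}
    (hI : ∀ t ≤ T, ∀ j, HasItoIntegral P (β j) (f j) t (I t j)) :
    TendstoInMeasure P (fun m ω ↦ ∑ k ∈ Finset.range m,
        (∑ j, I (gridTime T m (k + 1)) j ω - ∑ j, I (gridTime T m k) j ω) *
        (γ (gridTime T m (k + 1)) ω - γ (gridTime T m k) ω)) atTop
      (fun _ ↦ ∑ j, δ j * ∫ r in (0 : ℝ)..T, f j r) := by
  have : IsProbabilityMeasure P := hγ.isGaussianProcess.isProbabilityMeasure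
  set S : ι → ℕ → Ω → ℝ := fun j m ω ↦ ∑ k ∈ Finset.range m,
    (I (gridTime T m (k + 1)) j ω - I (gridTime T m k) j ω) *
      (γ (gridTime T m (k + 1)) ω - γ (gridTime T m k) ω) with hS
  have hsum : (fun m ω ↦ ∑ k ∈ Finset.range m,
        (∑ j, I (gridTime T m (k + 1)) j ω - ∑ j, I (gridTime T m k) j ω) *
        (γ (gridTime T m (k + 1)) ω - γ (gridTime T m k) ω)) = fun m ω ↦ ∑ j, S j m ω := by
    ext m ω
    rw [hS, Finset.sum_comm]
    refine Finset.sum_congr rfl fun k _ ↦ ?_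
    rw [← Finset.sum_sub_distrib, Finset.sum_mul]
  rw [hsum]
  have hSi (j : ι) (m : ℕ) : Integrable (S j m) P := by
    refine integrable_finsetSum _ fun k hk ↦ ?_
    have hk' := Finset.mem_range.1 hk
    exact ((hI _ (gridTime_le T hk') j).memLp_two.sub
      (hI _ (gridTime_le T hk'.le) j).memLp_two).integrable_mul
      ((memLp_two_brownian hγ _).sub (memLp_two_brownian hγ _))
  have hSlim (j : ι) : Tendsto (fun m ↦ ∫ ω, |S j m ω - δ j * ∫ r in (0 : ℝ)..T, f j r| ∂P)
      atTop (𝓝 0) := by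
    obtain ⟨C, hC⟩ := hX j
    exact tendsto_integral_abs_sum_increments_sub (hβ j) hγ hC (hf j)
      (I := fun m k ↦ I (gridTime T m k) j) fun m k hk ↦ hI _ (gridTime_le T hk) j
  have hdi (j : ι) (m : ℕ) :
      Integrable (fun ω ↦ |S j m ω - δ j * ∫ r in (0 : ℝ)..T, f j r|) P :=
    ((hSi j m).sub (integrable_const _)).abs
  refine tendstoInMeasure_of_tendsto_eLpNorm one_ne_zero
    (fun m ↦ (integrable_finsetSum _ fun j _ ↦ hSi j m).aestronglyMeasurable)
    aestronglyMeasurable_const ?_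
  have hlim : Tendsto (fun m ↦ ENNReal.ofReal
      (∑ j, ∫ ω, |S j m ω - δ j * ∫ r in (0 : ℝ)..T, f j r| ∂P)) atTop (𝓝 0) := by
    have := ENNReal.tendsto_ofReal (tendsto_finsetSum Finset.univ fun j _ ↦ hSlim j)
    simpa using this
  refine tendsto_of_tendsto_of_tendsto_of_le_of_le tendsto_const_nhds hlim
    (fun _ ↦ zero_le) fun m ↦ ?_
  have hint : Integrable ((fun ω ↦ ∑ j, S j m ω) -
      fun _ ↦ ∑ j, δ j * ∫ r in (0 : ℝ)..T, f j r) P :=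
    (integrable_finsetSum _ fun j _ ↦ hSi j m).sub (integrable_const _)
  dsimp only
  rw [eLpNorm_one_eq_lintegral_enorm, ← ofReal_integral_norm_eq_lintegral_enorm hint]
  refine ENNReal.ofReal_le_ofReal ?_
  rw [← integral_finsetSum _ fun j _ ↦ hdi j m]
  refine integral_mono hint.norm (integrable_finsetSum _ fun j _ ↦ hdi j m) fun ω ↦ ?_
  simp only [Pi.sub_apply, Real.norm_eq_abs]
  rw [← Finset.sum_sub_distrib]
  exact Finset.abs_sum_le_sum_abs _ _

/-- The covariation of two continuous semimartingales whose martingale parts are a sum of Wiener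
integrals and a Brownian motion, as an almost sure limit along subsequences. -/
theorem exists_subseq_tendsto_gridCovariation (hβ : ∀ j, IsPreBrownianReal (β j) P)
    (hγ : IsPreBrownianReal γ P) (hX : ∀ j, ∃ C, HasCrossVariation P (β j) γ (δ j) C)
    {f : ι → ℝ → ℝ} {T : ℝ≥0} {x y p q : Ω → ℝ → ℝ}
    (hf : ∀ j, MemLp (f j) 2 (volume.restrict (Set.Ioc 0 (T : ℝ))))
    (hx : ∀ ω, Continuous (x ω)) (hy : ∀ ω, Continuous (y ω))
    (hp : ∀ᵐ ω ∂P, IntervalIntegrable (p ω) volume 0 T)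
    (hq : ∀ᵐ ω ∂P, IntervalIntegrable (q ω) volume 0 T)
    (hxeq : ∀ t : ℝ≥0, t ≤ T → ∃ I : ι → Ω → ℝ, (∀ j, HasItoIntegral P (β j) (f j) t (I j)) ∧
      ∀ᵐ ω ∂P, x ω t = x ω 0 + (∫ r in (0 : ℝ)..t, p ω r) + ∑ j, I j ω)
    (hyeq : ∀ t : ℝ≥0, t ≤ T → ∀ᵐ ω ∂P, y ω t = (∫ r in (0 : ℝ)..t, q ω r) + γ t ω)
    {ns : ℕ → ℕ} (hns : Tendsto ns atTop atTop) :
    ∃ ks : ℕ → ℕ, StrictMono ks ∧ ∀ᵐ ω ∂P,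
      Tendsto (fun m ↦ gridCovariation T (ns (ks m)) (x ω) (y ω)) atTop
        (𝓝 (∑ j, δ j * ∫ r in (0 : ℝ)..T, f j r)) := by
  have hI' : ∀ t : ℝ≥0, ∃ I : ι → Ω → ℝ, t ≤ T → (∀ j, HasItoIntegral P (β j) (f j) t (I j)) ∧
      ∀ᵐ ω ∂P, x ω t = x ω 0 + (∫ r in (0 : ℝ)..t, p ω r) + ∑ j, I j ω := by
    intro t
    by_cases ht : t ≤ T
    · obtain ⟨I, hI⟩ := hxeq t ht
      exact ⟨I, fun _ ↦ hI⟩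
    · exact ⟨fun _ _ ↦ 0, fun h ↦ absurd h ht⟩
  choose I hI using hI'
  obtain ⟨ks, hks, hconv⟩ := ((tendstoInMeasure_sum_increments hβ hγ hX hf
    fun t ht ↦ (hI t ht).1).comp hns).exists_seq_tendsto_ae
  refine ⟨ks, hks, ?_⟩
  -- The equations hold almost surely at each fixed time only; all grids together have countably
  -- many points, so one null set suffices.
  have hxgrid : ∀ᵐ ω ∂P, ∀ m k, k ≤ m → x ω (gridTime T m k) =
      x ω 0 + (∫ r in (0 : ℝ)..gridTime T m k, p ω r) + ∑ j, I (gridTime T m k) j ω := by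
    refine ae_all_iff.2 fun m ↦ ae_all_iff.2 fun k ↦ ?_
    by_cases hk : k ≤ m
    · filter_upwards [(hI _ (gridTime_le T hk)).2] with ω h _ using h
    · exact .of_forall fun ω h ↦ absurd h hk
  have hygrid : ∀ᵐ ω ∂P, ∀ m k, k ≤ m → y ω (gridTime T m k) =
      (∫ r in (0 : ℝ)..gridTime T m k, q ω r) + γ (gridTime T m k) ω := by
    refine ae_all_iff.2 fun m ↦ ae_all_iff.2 fun k ↦ ?_
    by_cases hk : k ≤ m
    · filter_upwards [hyeq _ (gridTime_le T hk)] with ω h _ using h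
    · exact .of_forall fun ω h ↦ absurd h hk
  filter_upwards [hconv, hp, hq, hxgrid, hygrid] with ω hω hpω hqω hxω hyω
  have hcont : ContinuousOn (fun t : ℝ ↦ x ω t - ∫ r in (0 : ℝ)..t, p ω r) (Set.Icc 0 T) := by
    refine (hx ω).continuousOn.sub ?_
    have := intervalIntegral.continuousOn_primitive_interval' hpω Set.left_mem_uIcc
    rwa [Set.uIcc_of_le (NNReal.coe_nonneg T)] at this
  -- With `M` the sum of the Wiener integrals, `Δx Δy = ΔM Δγ + Δy Δ(∫p) + Δ(x - ∫p) Δ(∫q)`. Each of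
  -- the last two products pairs a continuous path with one of finite variation.
  have hmain := hω.add (((tendsto_sum_increments_mul_integral (hy ω).continuousOn hpω).add
    (tendsto_sum_increments_mul_integral hcont hqω)).comp (hns.comp hks.tendsto_atTop))
  rw [add_zero, add_zero] at hmain
  refine hmain.congr fun m ↦ ?_
  simp only [Function.comp, gridCovariation]
  rw [← Finset.sum_add_distrib, ← Finset.sum_add_distrib]
  refine Finset.sum_congr rfl fun k hk ↦ ?_
  have hk' := Finset.mem_range.1 hk
  rw [hxω _ _ hk', hxω _ _ hk'.le, hyω _ _ hk', hyω _ _ hk'.le]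
  ring

end Filtering

/-! ### From covariation to singular laws. -/

namespace Filtering

/-- Lebesgue differentiation: at almost every interior point `f` is the derivative of its primitive,
which is locally zero. -/
lemma ae_eq_zero_of_forall_intervalIntegral_eq_zero {f : ℝ → ℝ} {a b : ℝ} (hab : a ≤ b)
    (hf : IntervalIntegrable f volume a b) (h : ∀ t ∈ Set.Icc a b, ∫ r in a..t, f r = 0) :
    ∀ᵐ t ∂(volume.restrict (Set.Icc a b)), f t = 0 := by
  rw [← Measure.restrict_congr_set Ioo_ae_eq_Icc]
  refine (ae_restrict_iff' measurableSet_Ioo).2 ?_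
  filter_upwards [hf.ae_hasDerivAt_integral] with t ht hmem
  have hd := ht (by rw [Set.uIcc_of_le hab]; exact Set.Ioo_subset_Icc_self hmem) a
    (by rw [Set.uIcc_of_le hab]; exact Set.left_mem_Icc.2 hab)
  refine hd.unique ((hasDerivAt_const t (0 : ℝ)).congr_of_eventuallyEq ?_)
  filter_upwards [isOpen_Ioo.mem_nhds hmem] with r hr using h r (Set.Ioo_subset_Icc_self hr)

section Laws

variable {Ω E F : Type*} [MeasurableSpace Ω] [MeasurableSpace E] [MeasurableSpace F]
  {P : Measure Ω} [IsProbabilityMeasure P] {X : Ω → E} {Y : Ω → F}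

lemma mutuallySingular_prod_of_tendsto (hX : Measurable X) (hY : Measurable Y)
    {S : ℕ → E × F → ℝ} (hS : ∀ m, Measurable (S m)) {c c' : ℝ} (hc : c ≠ c')
    (hjoint : ∀ᵐ ω ∂P, Tendsto (fun m ↦ S m (X ω, Y ω)) atTop (𝓝 c))
    (hprod : ∀ᵐ ω ∂(P.prod P), Tendsto (fun m ↦ S m (X ω.1, Y ω.2)) atTop (𝓝 c')) :
    P.map (fun ω ↦ (X ω, Y ω)) ⟂ₘ (P.map X).prod (P.map Y) := by
  have hA : MeasurableSet {z | Tendsto (fun m ↦ S m z) atTop (𝓝 c)} :=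
    measurableSet_tendsto (𝓝 c) hS
  refine Measure.MutuallySingular.mk (s := {z | Tendsto (fun m ↦ S m z) atTop (𝓝 c)}ᶜ)
    (t := {z | Tendsto (fun m ↦ S m z) atTop (𝓝 c)}) ?_ ?_ (by simp)
  · rw [Measure.map_apply (hX.prodMk hY) hA.compl]
    exact hjoint
  · rw [Measure.map_prod_map P P hX hY, Measure.map_apply (hX.prodMap hY) hA]
    refine measure_mono_null (fun ω hω ↦ ?_) hprod
    exact fun h' ↦ hc (tendsto_nhds_unique hω h')

/-- Split `ν` into parts singular and absolutely continuous with respect to the law of `Y`. The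
singular part lives where `Y` almost surely is not; the other part gives a product dominated by the
product of the marginal laws, hence singular to the joint law. -/
lemma not_absolutelyContinuous_prod_of_mutuallySingular (hX : Measurable X) (hY : Measurable Y)
    (h : P.map (fun ω ↦ (X ω, Y ω)) ⟂ₘ (P.map X).prod (P.map Y)) (ν : Measure F) [SigmaFinite ν] :
    ¬ P.map (fun ω ↦ (X ω, Y ω)) ≪ (P.map X).prod ν := by
  intro hac
  have hXp : IsProbabilityMeasure (P.map X) := Measure.isProbabilityMeasure_map hX.aemeasurable
  have hYp : IsProbabilityMeasure (P.map Y) := Measure.isProbabilityMeasure_map hY.aemeasurable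
  have hXYp : IsProbabilityMeasure (P.map (fun ω ↦ (X ω, Y ω))) :=
    Measure.isProbabilityMeasure_map (hX.prodMk hY).aemeasurable
  obtain ⟨N, hN, hN1, hN2⟩ := h
  obtain ⟨s, hs, hs1, hs2⟩ := ν.mutuallySingular_singularPart (P.map Y)
  -- `Nᶜ` is null for the product of the marginals and `s` for the singular part of `ν`, yet both
  -- sets carry full mass under the joint law.
  have hnull : (P.map X).prod ν (Nᶜ ∩ Prod.snd ⁻¹' s) = 0 := by
    rw [ν.haveLebesgueDecomposition_add (P.map Y), Measure.prod_add, Measure.add_apply, add_eq_zero]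
    constructor
    · refine measure_mono_null Set.inter_subset_right ?_
      rw [← Set.univ_prod, Measure.prod_prod, hs1, mul_zero]
    · exact (Measure.AbsolutelyContinuous.rfl.prod (withDensity_absolutelyContinuous _ _))
        (measure_mono_null Set.inter_subset_left hN2)
  have hcompl : P.map (fun ω ↦ (X ω, Y ω)) (Nᶜ ∩ Prod.snd ⁻¹' s)ᶜ = 0 := by
    rw [Set.compl_inter, compl_compl]
    refine measure_union_null hN1 ?_
    rw [Measure.map_apply hY hs.compl] at hs2
    rw [Measure.map_apply (hX.prodMk hY) (measurable_snd hs).compl]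
    exact hs2
  have huniv : P.map (fun ω ↦ (X ω, Y ω)) Set.univ = 0 := by
    rw [← Set.union_compl_self (Nᶜ ∩ Prod.snd ⁻¹' s)]
    exact measure_union_null (hac hnull) hcompl
  simp at huniv

end Laws

lemma PathSpace.continuous_at_coord {T : ℝ} {m : ℕ} (hT : 0 ≤ T) (x : PathSpace T m)
    (i : Fin m) : Continuous (fun s ↦ x.at hT s i) :=
  (EuclideanSpace.proj (𝕜 := ℝ) i).continuous.comp (x.continuous.comp continuous_projIcc)

lemma PathSpace.measurable_at_coord {T : ℝ} {m : ℕ} (hT : 0 ≤ T) (s : ℝ) (i : Fin m) :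
    Measurable (fun x : PathSpace T m ↦ x.at hT s i) :=
  ((EuclideanSpace.proj (𝕜 := ℝ) i).continuous.comp
    (continuous_eval_const (Set.projIcc 0 T hT s))).measurable

lemma measurable_gridCovariation_at {T : ℝ} {d n : ℕ} (hT : 0 ≤ T) (t : ℝ≥0) (m : ℕ)
    (i : Fin d) (l : Fin n) :
    Measurable (fun z : PathSpace T d × PathSpace T n ↦
      gridCovariation t m (fun s ↦ z.1.at hT s i) (fun s ↦ z.2.at hT s l)) := by
  have h1 (s : ℝ) : Measurable (fun z : PathSpace T d × PathSpace T n ↦ z.1.at hT s i) :=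
    (PathSpace.measurable_at_coord hT s i).comp measurable_fst
  have h2 (s : ℝ) : Measurable (fun z : PathSpace T d × PathSpace T n ↦ z.2.at hT s l) :=
    (PathSpace.measurable_at_coord hT s l).comp measurable_snd
  exact Finset.measurable_fun_sum _ fun k _ ↦
    ((h1 _).sub (h1 _)).mul ((h2 _).sub (h2 _))

lemma intervalIntegrable_of_le_right {E : Type*} [NormedAddCommGroup E] {g : ℝ → E} {T : ℝ}
    {t : ℝ≥0} (ht : (t : ℝ) ≤ T) (hg : IntervalIntegrable g volume 0 T) :
    IntervalIntegrable g volume 0 t := by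
  refine hg.mono_set ?_
  rw [Set.uIcc_of_le (NNReal.coe_nonneg t), Set.uIcc_of_le ((NNReal.coe_nonneg t).trans ht)]
  exact Set.Icc_subset_Icc_right ht

lemma intervalIntegrable_euclidean_coord {m : ℕ} {g : ℝ → EuclideanSpace ℝ (Fin m)} {a b : ℝ}
    (hg : IntervalIntegrable g volume a b) (i : Fin m) :
    IntervalIntegrable (fun s ↦ g s i) volume a b :=
  ⟨(EuclideanSpace.proj (𝕜 := ℝ) i).integrable_comp hg.1,
    (EuclideanSpace.proj (𝕜 := ℝ) i).integrable_comp hg.2⟩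

lemma intervalIntegral_euclidean_coord {m : ℕ} {g : ℝ → EuclideanSpace ℝ (Fin m)} {a b : ℝ}
    (hg : IntervalIntegrable g volume a b) (i : Fin m) :
    (∫ s in a..b, g s) i = ∫ s in a..b, g s i :=
  ((EuclideanSpace.proj (𝕜 := ℝ) i).intervalIntegral_comp_comm hg).symm

lemma IsStdBrownian.hasCrossVariation {Ω ι : Type*} [MeasurableSpace Ω] [DecidableEq ι]
    {P : Measure Ω} {β : ι → ℝ≥0 → Ω → ℝ} (h : IsStdBrownian β P) (j k : ι) :
    ∃ C, HasCrossVariation P (β j) (β k) (if j = k then 1 else 0) C := by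
  by_cases hjk : j = k
  · subst hjk
    rw [if_pos rfl]
    exact ⟨_, .self (h.isBrownian j).toIsPreBrownianReal⟩
  · rw [if_neg hjk]
    exact ⟨_, .of_indepFun (h.isBrownian j).toIsPreBrownianReal
      (h.isBrownian k).toIsPreBrownianReal (h.indep.indepFun hjk)⟩

section SignalObservation

variable {Ω : Type*} [MeasurableSpace Ω] {P : Measure Ω} {T : ℝ} {hT : 0 ≤ T} {d n : ℕ}
  {b : ℝ → EuclideanSpace ℝ (Fin d) → EuclideanSpace ℝ (Fin d)}
  {σ₀ : ℝ → Matrix (Fin d) (Fin d) ℝ} {σ₁ : ℝ → Matrix (Fin d) (Fin n) ℝ}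
  {h : EuclideanSpace ℝ (Fin d) → EuclideanSpace ℝ (Fin n)}
  {B : Fin d → ℝ≥0 → Ω → ℝ} {W : Fin n → ℝ≥0 → Ω → ℝ}
  {X : Ω → PathSpace T d} {Y : Ω → PathSpace T n}

/-- Indexing `B` and `W` by one sum type lets a single Kronecker delta describe all covariations
with `W l`. -/
lemma IsSignalObservation.signal_coord_eq (hXY : IsSignalObservation P hT b σ₀ σ₁ h B W X Y)
    (i : Fin d) {t : ℝ≥0} (ht : (t : ℝ) ≤ T) :
    ∃ I : Fin d ⊕ Fin n → Ω → ℝ,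
      (∀ j, HasItoIntegral P (Sum.elim B W j)
        (Sum.elim (fun j s ↦ σ₀ s i j) (fun j s ↦ σ₁ s i j) j) t (I j)) ∧
      ∀ᵐ ω ∂P, (X ω).at hT t i = (X ω).at hT 0 i +
        (∫ s in (0 : ℝ)..t, b s ((X ω).at hT s) i) + ∑ j, I j ω := by
  obtain ⟨I₀, I₁, h₀, h₁, heq⟩ := hXY.signal_eq t ⟨t.2, ht⟩
  simp only [Real.toNNReal_coe] at h₀ h₁
  refine ⟨Sum.elim (I₀ i) (I₁ i), ?_, ?_⟩
  · rintro (j | j)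
    · exact h₀ i j
    · exact h₁ i j
  · filter_upwards [heq, hXY.drift_integrable] with ω hω hd
    rw [hω i, intervalIntegral_euclidean_coord (intervalIntegrable_of_le_right ht hd), Fintype.sum_sum_type]
    simp only [Sum.elim_inl, Sum.elim_inr]
    ring

lemma IsSignalObservation.observation_coord_eq
    (hXY : IsSignalObservation P hT b σ₀ σ₁ h B W X Y) (l : Fin n) {t : ℝ≥0} (ht : (t : ℝ) ≤ T) :
    ∀ᵐ ω ∂P, (Y ω).at hT t l = (∫ s in (0 : ℝ)..t, h ((X ω).at hT s) l) + W l t ω := by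
  filter_upwards [hXY.observation_eq t ⟨t.2, ht⟩, hXY.observation_integrable] with ω hω hd
  rw [hω l, intervalIntegral_euclidean_coord (intervalIntegrable_of_le_right ht hd), Real.toNNReal_coe]

lemma IsSignalObservation.memLp_coefficient (hXY : IsSignalObservation P hT b σ₀ σ₁ h B W X Y)
    (i : Fin d) {t : ℝ≥0} (ht : (t : ℝ) ≤ T) (j : Fin d ⊕ Fin n) :
    MemLp (Sum.elim (fun j s ↦ σ₀ s i j) (fun j s ↦ σ₁ s i j) j) 2
      (volume.restrict (Set.Ioc 0 (t : ℝ))) := by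
  obtain ⟨I, hI, -⟩ := hXY.signal_coord_eq i ht
  exact (hI j).1

lemma IsSignalObservation.isPreBrownianReal (hXY : IsSignalObservation P hT b σ₀ σ₁ h B W X Y)
    (j : Fin d ⊕ Fin n) : IsPreBrownianReal (Sum.elim B W j) P :=
  (hXY.brownian.isBrownian j).toIsPreBrownianReal

lemma IsSignalObservation.exists_subseq_tendsto_covariation
    (hXY : IsSignalObservation P hT b σ₀ σ₁ h B W X Y) (i : Fin d) (l : Fin n) {t : ℝ≥0}
    (ht : (t : ℝ) ≤ T) :
    ∃ ks : ℕ → ℕ, StrictMono ks ∧ ∀ᵐ ω ∂P,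
      Tendsto (fun m ↦ gridCovariation t (ks m) (fun s ↦ (X ω).at hT s i)
        (fun s ↦ (Y ω).at hT s l)) atTop (𝓝 (∫ s in (0 : ℝ)..t, σ₁ s i l)) := by
  obtain ⟨ks, hks, hlim⟩ := exists_subseq_tendsto_gridCovariation (T := t)
    (p := fun ω s ↦ b s ((X ω).at hT s) i) (q := fun ω s ↦ h ((X ω).at hT s) l)
    hXY.isPreBrownianReal (hXY.isPreBrownianReal (Sum.inr l))
    (fun j ↦ hXY.brownian.hasCrossVariation j (Sum.inr l)) (hXY.memLp_coefficient i ht)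
    (fun ω ↦ (X ω).continuous_at_coord hT i) (fun ω ↦ (Y ω).continuous_at_coord hT l)
    (hXY.drift_integrable.mono fun ω hω ↦ intervalIntegrable_euclidean_coord (intervalIntegrable_of_le_right ht hω) i)
    (hXY.observation_integrable.mono fun ω hω ↦ intervalIntegrable_euclidean_coord (intervalIntegrable_of_le_right ht hω) l)
    (fun s hs ↦ hXY.signal_coord_eq i (le_trans (by exact_mod_cast hs) ht))
    (fun s hs ↦ hXY.observation_coord_eq l (le_trans (by exact_mod_cast hs) ht))
    (ns := id) tendsto_id
  refine ⟨ks, hks, ?_⟩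
  -- Only the index `Sum.inr l` has `δ = 1`, which leaves the integral of `σ₁ s i l`.
  simpa using hlim

/-- The arbitrary sequence `ns` allows refining the subsequence already found for the joint law. -/
lemma IsSignalObservation.exists_subseq_tendsto_covariation_prod [IsProbabilityMeasure P]
    (hXY : IsSignalObservation P hT b σ₀ σ₁ h B W X Y) (i : Fin d) (l : Fin n) {t : ℝ≥0}
    (ht : (t : ℝ) ≤ T) {ns : ℕ → ℕ} (hns : Tendsto ns atTop atTop) :
    ∃ ks : ℕ → ℕ, StrictMono ks ∧ ∀ᵐ ω ∂(P.prod P),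
      Tendsto (fun m ↦ gridCovariation t (ns (ks m)) (fun s ↦ (X ω.1).at hT s i)
        (fun s ↦ (Y ω.2).at hT s l)) atTop (𝓝 0) := by
  have h1 : MeasurePreserving Prod.fst (P.prod P) P := measurePreserving_fst
  have h2 : MeasurePreserving Prod.snd (P.prod P) P := measurePreserving_snd
  obtain ⟨ks, hks, hlim⟩ := exists_subseq_tendsto_gridCovariation (P := P.prod P) (T := t)
    (δ := fun _ ↦ 0) (x := fun ω s ↦ (X ω.1).at hT s i) (y := fun ω s ↦ (Y ω.2).at hT s l)
    (p := fun ω s ↦ b s ((X ω.1).at hT s) i) (q := fun ω s ↦ h ((X ω.2).at hT s) l)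
    (fun j ↦ IsPreBrownianReal.comp_measurePreserving (hXY.isPreBrownianReal j) h1)
    (IsPreBrownianReal.comp_measurePreserving (hXY.isPreBrownianReal (Sum.inr l)) h2)
    (fun j ↦ ⟨1, .prod (hXY.isPreBrownianReal j) (hXY.isPreBrownianReal (Sum.inr l))⟩)
    (hXY.memLp_coefficient i ht)
    (fun ω ↦ (X ω.1).continuous_at_coord hT i) (fun ω ↦ (Y ω.2).continuous_at_coord hT l)
    (h1.quasiMeasurePreserving.ae (hXY.drift_integrable.mono fun ω hω ↦
      intervalIntegrable_euclidean_coord (intervalIntegrable_of_le_right ht hω) i))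
    (h2.quasiMeasurePreserving.ae (hXY.observation_integrable.mono fun ω hω ↦
      intervalIntegrable_euclidean_coord (intervalIntegrable_of_le_right ht hω) l))
    (fun s hs ↦ by
      obtain ⟨I, hI, heq⟩ := hXY.signal_coord_eq i (le_trans (NNReal.coe_le_coe.2 hs) ht)
      exact ⟨fun j ω ↦ I j ω.1,
        fun j ↦ (hI j).comp_measurePreserving (hXY.isPreBrownianReal j) h1,
        h1.quasiMeasurePreserving.ae heq⟩)
    (fun s hs ↦ h2.quasiMeasurePreserving.ae
      (hXY.observation_coord_eq l (le_trans (NNReal.coe_le_coe.2 hs) ht)))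
    hns
  refine ⟨ks, hks, ?_⟩
  simpa using hlim

lemma exists_intervalIntegral_entry_ne_zero (hT : 0 ≤ T)
    (hσ₁ : ∀ i j, MemLp (fun t ↦ σ₁ t i j) 2 (volume.restrict (Set.Icc 0 T)))
    (hcorr : ¬ ∀ᵐ t ∂(volume.restrict (Set.Icc 0 T)), σ₁ t = 0) :
    ∃ i l, ∃ t : ℝ≥0, (t : ℝ) ≤ T ∧ ∫ s in (0 : ℝ)..t, σ₁ s i l ≠ 0 := by
  by_contra! hzero
  refine hcorr ?_
  have hentry : ∀ i l, ∀ᵐ t ∂(volume.restrict (Set.Icc 0 T)), σ₁ t i l = 0 := fun i l ↦ by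
    refine ae_eq_zero_of_forall_intervalIntegral_eq_zero hT ?_
      fun t ht ↦ hzero i l ⟨t, ht.1⟩ ht.2
    exact (intervalIntegrable_iff_integrableOn_Icc_of_le hT).2
      ((hσ₁ i l).integrable (by norm_num))
  filter_upwards [ae_all_iff.2 fun i ↦ ae_all_iff.2 (hentry i)] with t ht
  ext i l
  exact ht i l

end SignalObservation

end Filtering

theorem theorem5p4 {Ω : Type*} [MeasurableSpace Ω] (P : Measure Ω) [IsProbabilityMeasure P]
    {T : ℝ} (hT : 0 < T) {d n : ℕ}
    (b : ℝ → EuclideanSpace ℝ (Fin d) → EuclideanSpace ℝ (Fin d))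
    (hb : Measurable (Function.uncurry b))
    (hb_lin : ∀ t ∈ Set.Icc (0 : ℝ) T, IsLinearMap ℝ (b t))
    (σ₀ : ℝ → Matrix (Fin d) (Fin d) ℝ) (σ₁ : ℝ → Matrix (Fin d) (Fin n) ℝ)
    (hσ₀ : ∀ i j, MemLp (fun t ↦ σ₀ t i j) 2 (volume.restrict (Set.Icc 0 T)))
    (hσ₁ : ∀ i j, MemLp (fun t ↦ σ₁ t i j) 2 (volume.restrict (Set.Icc 0 T)))
    -- the noises are correlated: `σ₁` does not vanish almost everywhere on `[0,T]`
    (hcorr : ¬ ∀ᵐ t ∂(volume.restrict (Set.Icc 0 T)), σ₁ t = 0)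
    (h : EuclideanSpace ℝ (Fin d) → EuclideanSpace ℝ (Fin n)) (hh : Measurable h)
    (B : Fin d → ℝ≥0 → Ω → ℝ) (W : Fin n → ℝ≥0 → Ω → ℝ)
    (X : Ω → Filtering.PathSpace T d) (Y : Ω → Filtering.PathSpace T n)
    (hXY : Filtering.IsSignalObservation P hT.le b σ₀ σ₁ h B W X Y) :
    (P.map (fun ω ↦ (X ω, Y ω))) ⟂ₘ (P.map X).prod (P.map Y) ∧
    ¬ ∃ lamY : Measure (Filtering.PathSpace T n), SigmaFinite lamY ∧
      P.map (fun ω ↦ (X ω, Y ω)) ≪ (P.map X).prod lamY := by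
  obtain ⟨i, l, t, ht, hne⟩ := Filtering.exists_intervalIntegral_entry_ne_zero hT.le hσ₁ hcorr
  obtain ⟨ns, hns, hjoint⟩ := hXY.exists_subseq_tendsto_covariation i l ht
  -- Refining `ns` keeps the joint limit, so along `ns ∘ ks` both limits hold for the same
  -- functionals.
  obtain ⟨ks, hks, hprod⟩ :=
    hXY.exists_subseq_tendsto_covariation_prod i l ht hns.tendsto_atTop
  have hsing := Filtering.mutuallySingular_prod_of_tendsto hXY.measurable_signal
    hXY.measurable_observation
    (fun m ↦ Filtering.measurable_gridCovariation_at hT.le t (ns (ks m)) i l) hne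
    (hjoint.mono fun ω hω ↦ hω.comp hks.tendsto_atTop) hprod
  refine ⟨hsing, ?_⟩
  rintro ⟨lamY, hlam, hac⟩
  exact Filtering.not_absolutelyContinuous_prod_of_mutuallySingular hXY.measurable_signal
    hXY.measurable_observation hsing lamY hac
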